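/- All monoids are commutative and written multiplicatively; prime ideals of a monoid may be empty. A monoid scheme is a topological space $X$ with a sheaf of monoids $\mathcal O_X$ that is locally isomorphic to $(\mathrm{Spec}(M),\mathcal O_M)$ for monoids $M$. For points write $q\le p$ if $p\in\overline{\{q\}}$; then there is a localisation map $\mathcal O_{X,p}\to\mathcal O_{X,q}$. The scheme $X$ is called $s$-cancellative if $\mathcal O_{X,p}^*\to\mathcal O_{X,q}^*$ is injective whenever $q\le p$. An element $a$ of a monoid $M$ is $s$-regular if, for all $m\in\mathbb N$ and $u,v\in M$, the equality $a^mu=a^mv$ implies $(uv)^nu=(uv)^nv$ for some $n\in\mathbb N$. The $s$-regular elements form a submonoid $S(M)$, and localisation maps preserve $s$-regularity. Let $s\mathcal M_X$ be the sheaf associated to the contravariant functor $x\mapsto(\mathcal O_{X,x})_{S(\mathcal O_{X,x})}$ on the points of $X$, i.e. $s\mathcal M_X(U)=\lim_{x\in U}(\mathcal O_{X,x})_{S(\mathcal O_{X,x})}$. Let $s\mathcal M_X^*$ be its sheaf of invertible elements; $\mathcal O_X^*$ is a subsheaf of $s\mathcal M_X^*$. An $s$-divisor is a global section of the quotient sheaf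 $s\mathcal M_X^*/\mathcal O_X^*$; it is principal if it is the image of an element of $s\mathcal M_X^*(X)$. Let $s\mathrm{Cl}(X)$ be the group of $s$-divisors modulo principal ones. Let $\mathrm{Pic}(X)$ be the group, under tensor product over $\mathcal O_X$, of isomorphism classes of line bundles, i.e. of sheaves of sets with an action of $\mathcal O_X$ that are locally isomorphic to $\mathcal O_X$. **Proposition.** Let $X$ be a monoid scheme. There is an injective group homomorphism $s\mathrm{Cl}(X)\to\mathrm{Pic}(X)$, namely the one that sends the class of an $s$-divisor $D$ to the class of a line bundle $L$ exactly when the $\mathcal O_X^*$-torsor of local sections of $s\mathcal M_X^*$ representing $D$ is isomorphic to the torsor of local generators of $L$ (the connecting homomorphism of $1\to\mathcal O_X^*\to s\mathcal M_X^*\to s\mathcal M_X^*/\mathcal O_X^*\to1$). If $X$ is $s$-cancellative, then this homomorphism is an isomorphism; moreover the restriction of $s\mathcal M_X^*$ to every connected open subset of $X$ is then a constant sheaf. -/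

import Mathlib

open CategoryTheory TopologicalSpace Opposite

universe u

noncomputable section

namespace MonoidGeometry

/-! ### Colimits of commutative monoids (needed to speak about stalks) -/

/-- The largest commutative quotient of a monoid. -/
def commCon (A : Type u) [Monoid A] : Con A :=
  conGen fun a b => ∃ x y, a = x * y ∧ b = y * x

instance commConQuotient (A : Type u) [Monoid A] : CommMonoid (commCon A).Quotient :=
  { (inferInstance : Monoid (commCon A).Quotient) with
    mul_comm := fun a b => by
      induction a, b using Con.induction_on₂ with
      | _ x y => exact (Con.eq _).2 (ConGen.Rel.of _ _ ⟨x, y, rfl, rfl⟩) }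

/-- Homomorphisms from the commutative quotient are homomorphisms from the monoid. -/
def commConEquiv (A : MonCat.{u}) (B : CommMonCat.{u}) :
    (CommMonCat.of (commCon A).Quotient ⟶ B) ≃ (A ⟶ (forget₂ CommMonCat MonCat).obj B) where
  toFun f := MonCat.ofHom (f.hom.comp (commCon A).mk')
  invFun g := CommMonCat.ofHom <| (commCon A).lift g.hom <| by
    refine Con.conGen_le.2 ?_
    rintro _ _ ⟨x, y, rfl, rfl⟩
    have h : (g.hom x * g.hom y : B) = g.hom y * g.hom x := mul_comm (G := B) _ _
    simpa [Con.ker_rel] using h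
  left_inv f := by
    ext x
    rfl
  right_inv g := by
    ext x
    rfl

instance : (forget₂ CommMonCat.{u} MonCat.{u}).IsRightAdjoint :=
  ⟨_, ⟨Adjunction.adjunctionOfEquivLeft (G := forget₂ CommMonCat.{u} MonCat.{u})
    (F_obj := fun A => CommMonCat.of (commCon A).Quotient) commConEquiv
    (fun _ _ _ _ _ => rfl)⟩⟩

instance : Reflective (forget₂ CommMonCat.{u} MonCat.{u}) where
  L := _
  adj := Adjunction.ofIsRightAdjoint _

instance : Limits.HasColimits CommMonCat.{u} :=
  hasColimits_of_reflective (forget₂ CommMonCat.{u} MonCat.{u})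

/-! ### Sheaves of monoids consisting of families of elements -/

/-- The sheaf of commutative monoids whose sections over `U` are the families
`(s x ∈ T x)` for `x ∈ U` that satisfy a local condition stable under products. -/
def sheafOfFamilies {X : TopCat.{u}} (T : X → Type u) [∀ x, CommMonoid (T x)]
    (P : TopCat.LocalPredicate T)
    (one : ∀ U : Opens X, P.pred (U := U) 1)
    (mul : ∀ (U : Opens X) (f g : ∀ x : U, T x), P.pred f → P.pred g → P.pred (f * g)) :
    TopCat.Sheaf CommMonCat.{u} X where
  obj :=
    { obj := fun U => CommMonCat.of
        ({ carrier := {f | P.pred f}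
           one_mem' := one _
           mul_mem' := fun {a b} => mul _ a b } : Submonoid (∀ x : U.unop, T x))
      map := fun i => CommMonCat.ofHom
        { toFun := fun f => ⟨fun x => f.1 (i.unop x), P.res i.unop f.1 f.2⟩
          map_one' := rfl
          map_mul' := fun _ _ => rfl } }
  property := (TopCat.Presheaf.isSheaf_iff_isSheaf_comp (forget CommMonCat.{u}) _).2
    (TopCat.subpresheafToTypes.isSheaf P)

/-! ### The spectrum of a monoid -/

/-- The points of `Spec M`: prime ideals of the commutative monoid `M`, the empty one included. -/
@[ext]
structure PrimeIdeal (M : Type u) [CommMonoid M] where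
  carrier : Set M
  mul_mem : ∀ (a : M) {b : M}, b ∈ carrier → a * b ∈ carrier
  one_notMem : (1 : M) ∉ carrier
  mem_or_mem : ∀ {a b : M}, a * b ∈ carrier → a ∈ carrier ∨ b ∈ carrier

namespace PrimeIdeal

variable {M : Type u} [CommMonoid M]

/-- The complement of a prime ideal. -/
def compl (p : PrimeIdeal M) : Submonoid M where
  carrier := p.carrierᶜ
  one_mem' := p.one_notMem
  mul_mem' ha hb h := (p.mem_or_mem h).elim ha hb

/-- The set `D(f)` of primes that do not contain `f`. -/
def D (f : M) : Set (PrimeIdeal M) := {p | f ∉ p.carrier}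

/-- The topology of `Spec M`, generated by the sets `D(f)`
(which form a basis, as `D(f) ∩ D(g) = D(fg)` and `D(1)` is everything). -/
instance : TopologicalSpace (PrimeIdeal M) := generateFrom (Set.range D)

lemma isOpen_D (f : M) : IsOpen (D f) := isOpen_generateFrom_of_mem ⟨f, rfl⟩

variable (M) in
/-- Families `(s p ∈ M_p)` of the form `a / f` with `a, f ∈ M`. -/
def isFraction : TopCat.PrelocalPredicate
    (X := TopCat.of (PrimeIdeal M)) (fun p => Localization p.compl) where
  pred {U} s := ∃ a f : M, ∀ p : U, ∃ h : f ∈ p.1.compl, s p = Localization.mk a ⟨f, h⟩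
  res := by rintro V U i s ⟨a, f, w⟩; exact ⟨a, f, fun p => w ⟨p.1, i.le p.2⟩⟩

variable (M) in
/-- The structure sheaf of `Spec M`: families `(s p ∈ M_p)` that are locally of the form `a / f`.
On `D(f)` it is the localisation `M_f`, and its stalk at `p` is `M_p`. -/
def structureSheaf : TopCat.Sheaf CommMonCat.{u} (TopCat.of (PrimeIdeal M)) :=
  sheafOfFamilies (fun p => Localization p.compl) (isFraction M).sheafify
    (fun U x => ⟨U, x.2, 𝟙 U, 1, 1, fun p => ⟨p.1.compl.one_mem, Localization.mk_one.symm⟩⟩)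
    (fun U s t hs ht x => by
      obtain ⟨V, hV, i, a, f, h⟩ := hs x
      obtain ⟨W, hW, j, b, g, k⟩ := ht x
      refine ⟨V ⊓ W, ⟨hV, hW⟩, Opens.infLELeft _ _ ≫ i, a * b, f * g, fun p => ?_⟩
      obtain ⟨h1, h2⟩ := h ⟨p.1, p.2.1⟩
      obtain ⟨k1, k2⟩ := k ⟨p.1, p.2.2⟩
      exact ⟨p.1.compl.mul_mem h1 k1,
        (congrArg₂ (· * ·) h2 k2).trans (Localization.mk_mul _ _ _ _)⟩)

end PrimeIdeal

/-- The affine monoid scheme `(Spec M, O_M)`. -/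
def Spec (M : CommMonCat.{u}) : AlgebraicGeometry.SheafedSpace CommMonCat.{u} where
  carrier := TopCat.of (PrimeIdeal M)
  presheaf := (PrimeIdeal.structureSheaf M).obj
  IsSheaf := (PrimeIdeal.structureSheaf M).property

/-- A monoid scheme: a space with a sheaf of commutative monoids that is locally isomorphic to
some `(Spec M, O_M)`. (An isomorphism of spaces with sheaves of monoids is local.) -/
structure MonoidScheme extends AlgebraicGeometry.SheafedSpace CommMonCat.{u} where
  local_affine : ∀ x : toSheafedSpace, ∃ (U : OpenNhds x) (M : CommMonCat.{u}),
    Nonempty (toSheafedSpace.restrict U.isOpenEmbedding ≅ Spec M)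

/-! ### `s`-regular elements -/

section Algebra

variable {A B C : Type u} [CommMonoid A] [CommMonoid B] [CommMonoid C]

/-- An element `a` is `s`-regular if `a ^ m * u = a ^ m * v` implies
`(u * v) ^ n * u = (u * v) ^ n * v` for some `n`. -/
def IsSRegular (a : A) : Prop :=
  ∀ (m : ℕ) (u v : A), a ^ m * u = a ^ m * v → ∃ n : ℕ, (u * v) ^ n * u = (u * v) ^ n * v

lemma isSRegular_one : IsSRegular (1 : A) := fun m u v h => ⟨0, by simpa using h⟩

lemma IsSRegular.mul {a b : A} (ha : IsSRegular a) (hb : IsSRegular b) : IsSRegular (a * b) := by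
  intro m u v h
  obtain ⟨n, hn⟩ := ha m (b ^ m * u) (b ^ m * v) (by
    simpa only [mul_pow, mul_assoc] using h)
  obtain ⟨k, hk⟩ := hb (m * (2 * n + 1)) ((u * v) ^ n * u) ((u * v) ^ n * v) (by
    calc b ^ (m * (2 * n + 1)) * ((u * v) ^ n * u)
        = (b ^ m * u * (b ^ m * v)) ^ n * (b ^ m * u) := by
          rw [pow_mul, pow_succ, pow_mul]; simp only [mul_pow, pow_two]; ac_rfl
      _ = _ := hn
      _ = b ^ (m * (2 * n + 1)) * ((u * v) ^ n * v) := by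
          rw [pow_mul, pow_succ, pow_mul]; simp only [mul_pow, pow_two]; ac_rfl)
  refine ⟨(2 * n + 1) * k + n, ?_⟩
  calc (u * v) ^ ((2 * n + 1) * k + n) * u
      = ((u * v) ^ n * u * ((u * v) ^ n * v)) ^ k * ((u * v) ^ n * u) := by
        rw [pow_add, pow_mul, pow_succ, pow_mul]; simp only [mul_pow, pow_two]; ac_rfl
    _ = _ := hk
    _ = (u * v) ^ ((2 * n + 1) * k + n) * v := by
        rw [pow_add, pow_mul, pow_succ, pow_mul]; simp only [mul_pow, pow_two]; ac_rfl

variable (A) in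
/-- The multiplicative subset `S(A)` of `s`-regular elements. -/
def sRegular : Submonoid A where
  carrier := {a | IsSRegular a}
  one_mem' := isSRegular_one
  mul_mem' := IsSRegular.mul

/-- A homomorphism that exhibits `B` as a localisation of `A`
(at the elements that become invertible). -/
def IsLocalizing (f : A →* B) : Prop :=
  (∀ c : B, ∃ d e : A, IsUnit (f d) ∧ c * f d = f e) ∧
    ∀ a b : A, f a = f b → ∃ d : A, IsUnit (f d) ∧ d * a = d * b

lemma IsLocalizing.map_isSRegular {f : A →* B} (hf : IsLocalizing f) {a : A}
    (ha : IsSRegular a) : IsSRegular (f a) := by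
  intro m u v h
  obtain ⟨d₁, e₁, hd₁, h₁⟩ := hf.1 u
  obtain ⟨d₂, e₂, hd₂, h₂⟩ := hf.1 v
  obtain ⟨k, hk, hk'⟩ := hf.2 (a ^ m * (e₁ * d₂)) (a ^ m * (e₂ * d₁)) (by
    simp only [map_mul, map_pow, ← h₁, ← h₂]
    calc f a ^ m * (u * f d₁ * f d₂) = (f a ^ m * u) * (f d₁ * f d₂) := by ac_rfl
      _ = (f a ^ m * v) * (f d₁ * f d₂) := by rw [h]
      _ = f a ^ m * (v * f d₂ * f d₁) := by ac_rfl)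
  obtain ⟨n, hn⟩ := ha m (k * (e₁ * d₂)) (k * (e₂ * d₁)) (by
    rw [mul_left_comm, hk', mul_left_comm])
  have hn' := congrArg f hn
  simp only [map_mul, map_pow, ← h₁, ← h₂] at hn'
  have hw : IsUnit ((f k * (f d₁ * f d₂)) ^ (2 * n + 1)) := (hk.mul (hd₁.mul hd₂)).pow _
  refine ⟨n, hw.mul_left_cancel ?_⟩
  calc (f k * (f d₁ * f d₂)) ^ (2 * n + 1) * ((u * v) ^ n * u)
      = (f k * (u * f d₁ * f d₂) * (f k * (v * f d₂ * f d₁))) ^ n * (f k * (u * f d₁ * f d₂)) := by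
        rw [pow_succ, pow_mul]; simp only [mul_pow, pow_two]; ac_rfl
    _ = _ := hn'
    _ = (f k * (f d₁ * f d₂)) ^ (2 * n + 1) * ((u * v) ^ n * v) := by
        rw [pow_succ, pow_mul]; simp only [mul_pow, pow_two]; ac_rfl

lemma IsLocalizing.comp_mulEquiv {f : A →* B} (hf : IsLocalizing f) (e : C ≃* A) :
    IsLocalizing (f.comp e.toMonoidHom) := by
  refine ⟨fun c => ?_, fun a b h => ?_⟩
  · obtain ⟨d, x, h1, h2⟩ := hf.1 c
    exact ⟨e.symm d, e.symm x, by simpa using h1, by simpa using h2⟩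
  · obtain ⟨d, h1, h2⟩ := hf.2 _ _ h
    exact ⟨e.symm d, by simpa using h1, e.injective (by simpa using h2)⟩

lemma IsLocalizing.mulEquiv_comp {f : A →* B} (hf : IsLocalizing f) (e : B ≃* C) :
    IsLocalizing (e.toMonoidHom.comp f) := by
  refine ⟨fun c => ?_, fun a b h => ?_⟩
  · obtain ⟨d, x, h1, h2⟩ := hf.1 (e.symm c)
    exact ⟨d, x, by simpa using h1, e.symm.injective (by simpa using h2)⟩
  · obtain ⟨d, h1, h2⟩ := hf.2 a b (e.injective h)
    exact ⟨d, by simpa using h1, h2⟩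

/-- The map `A_{S(A)} → B_{S(B)}` induced by a homomorphism preserving `s`-regular elements. -/
def sLocMap (f : A →* B) (hf : ∀ a, IsSRegular a → IsSRegular (f a)) :
    Localization (sRegular A) →* Localization (sRegular B) :=
  (Localization.monoidOf (sRegular A)).lift
    (g := (Localization.monoidOf (sRegular B)).toMonoidHom.comp f)
    fun s => (Localization.monoidOf (sRegular B)).map_units ⟨f s, hf _ s.2⟩

end Algebra

/-! ### Specialisation maps of a monoid scheme are localisations -/

section Specialization

open AlgebraicGeometry TopCat.Presheaf

lemma isLocalizing_of_stalkMap {Y Z : PresheafedSpace CommMonCat.{u}} (α : Y ⟶ Z)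
    [∀ y : Y, IsIso (α.stalkMap y)] {x y : Y} (h : x ⤳ y)
    (h' : α.base x ⤳ α.base y) :
    IsLocalizing (Y.presheaf.stalkSpecializes h).hom ↔
      IsLocalizing (Z.presheaf.stalkSpecializes h').hom := by
  have key := PresheafedSpace.stalkMap.stalkSpecializes_stalkMap α h
  constructor
  · intro H
    have e : Z.presheaf.stalkSpecializes h' =
        α.stalkMap y ≫ Y.presheaf.stalkSpecializes h ≫ inv (α.stalkMap x) := by
      rw [← Category.assoc, IsIso.eq_comp_inv]; exact key
    rw [e]
    exact (H.mulEquiv_comp (asIso (α.stalkMap x)).symm.commMonCatIsoToMulEquiv).comp_mulEquiv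
      (asIso (α.stalkMap y)).commMonCatIsoToMulEquiv
  · intro H
    have e : Y.presheaf.stalkSpecializes h =
        inv (α.stalkMap y) ≫ Z.presheaf.stalkSpecializes h' ≫ α.stalkMap x := by
      rw [IsIso.eq_inv_comp]; exact key.symm
    rw [e]
    exact (H.mulEquiv_comp (asIso (α.stalkMap x)).commMonCatIsoToMulEquiv).comp_mulEquiv
      (asIso (α.stalkMap y)).symm.commMonCatIsoToMulEquiv

open PrimeIdeal in
/-- The germ at `x ∈ Spec M` of the section `a / f` of the structure sheaf over `D(f)`. -/
def fracGerm (M : CommMonCat.{u}) (x : Spec M) (a f : M) (h : f ∉ PrimeIdeal.carrier x) :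
    (Spec M).presheaf.stalk x :=
  (Spec M).presheaf.germ (⟨D f, isOpen_D f⟩ : Opens (TopCat.of (PrimeIdeal M))) x h
    ⟨fun p => Localization.mk a ⟨f, p.2⟩, fun p => ⟨_, p.2, 𝟙 _, a, f, fun q => ⟨q.2, rfl⟩⟩⟩

lemma exists_eq_fracGerm (M : CommMonCat.{u}) (x : Spec M) (c : (Spec M).presheaf.stalk x) :
    ∃ (a f : M) (h : f ∉ PrimeIdeal.carrier x), c = fracGerm M x a f h := by
  obtain ⟨U, hU, s, rfl⟩ := exists_germ_eq _ c
  obtain ⟨V, hV, i, a, f, H⟩ := s.2 ⟨x, hU⟩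
  refine ⟨a, f, (H ⟨x, hV⟩).1, ?_⟩
  refine germ_ext _ V hV i (homOfLE fun p hp => (H ⟨p, hp⟩).1) ?_
  apply Subtype.ext
  funext p
  exact (H p).2

open PrimeIdeal in
lemma fracGerm_eq (M : CommMonCat.{u}) (x : Spec M) (a f b g : M)
    (hf : f ∉ PrimeIdeal.carrier x) (hg : g ∉ PrimeIdeal.carrier x)
    (h : g * a = f * b) : fracGerm M x a f hf = fracGerm M x b g hg := by
  let V : Opens (TopCat.of (PrimeIdeal M)) := ⟨D f, isOpen_D f⟩ ⊓ ⟨D g, isOpen_D g⟩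
  refine germ_ext _ V ⟨hf, hg⟩ (Opens.infLELeft _ _) (Opens.infLERight _ _) ?_
  apply Subtype.ext
  funext p
  exact Localization.mk_eq_mk_iff.2 (Localization.r_of_eq h)

open PrimeIdeal in
lemma fracGerm_mul (M : CommMonCat.{u}) (x : Spec M) (a f b g : M)
    (hf : f ∉ PrimeIdeal.carrier x) (hg : g ∉ PrimeIdeal.carrier x) :
    fracGerm M x a f hf * fracGerm M x b g hg =
      fracGerm M x (a * b) (f * g) fun h => (PrimeIdeal.mem_or_mem x h).elim hf hg := by
  let V : Opens (TopCat.of (PrimeIdeal M)) := ⟨D (f * g), isOpen_D (f * g)⟩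
  have hV : x ∈ V := fun h => (PrimeIdeal.mem_or_mem x h).elim hf hg
  let i : V ⟶ (⟨D f, isOpen_D f⟩ : Opens (TopCat.of (PrimeIdeal M))) :=
    homOfLE fun p hp h => hp (by rw [mul_comm]; exact p.mul_mem g h)
  let j : V ⟶ (⟨D g, isOpen_D g⟩ : Opens (TopCat.of (PrimeIdeal M))) :=
    homOfLE fun p hp h => hp (p.mul_mem f h)
  refine (congrArg₂ (· * ·) (germ_res_apply _ i x hV _).symm
    (germ_res_apply _ j x hV _).symm).trans ?_
  refine (map_mul ((Spec M).presheaf.germ V x hV).hom _ _).symm.trans ?_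
  refine congrArg ((Spec M).presheaf.germ V x hV).hom (Subtype.ext (funext fun p => ?_))
  exact Localization.mk_mul _ _ _ _

open PrimeIdeal in
lemma fracGerm_one (M : CommMonCat.{u}) (x : Spec M) :
    fracGerm M x 1 1 (PrimeIdeal.one_notMem x) = 1 := by
  unfold fracGerm
  rw [← map_one ((Spec M).presheaf.germ (⟨D 1, isOpen_D 1⟩ : Opens (TopCat.of (PrimeIdeal M)))
    x (PrimeIdeal.one_notMem x)).hom]
  congr 1
  apply Subtype.ext
  funext p
  exact Localization.mk_one

lemma fracGerm_specializes (M : CommMonCat.{u}) {x y : Spec M} (h : x ⤳ y) (a f : M)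
    (hy : f ∉ PrimeIdeal.carrier y) (hx : f ∉ PrimeIdeal.carrier x) :
    ((Spec M).presheaf.stalkSpecializes h).hom (fracGerm M y a f hy) = fracGerm M x a f hx := by
  unfold fracGerm
  exact germ_stalkSpecializes_apply _ _ _ _

lemma isLocalizing_spec (M : CommMonCat.{u}) {x y : Spec M} (h : x ⤳ y) :
    IsLocalizing ((Spec M).presheaf.stalkSpecializes h).hom := by
  have hle : ∀ f : M, f ∉ PrimeIdeal.carrier y → f ∉ PrimeIdeal.carrier x := fun f hf =>
    h.mem_open (PrimeIdeal.isOpen_D f) hf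
  have isUnit_germ : ∀ f : M, f ∉ PrimeIdeal.carrier x →
      IsUnit (fracGerm M x f 1 (PrimeIdeal.one_notMem x)) := by
    intro f hf
    refine IsUnit.of_mul_eq_one (fracGerm M x 1 f hf) ?_
    rw [fracGerm_mul, ← fracGerm_one]
    apply fracGerm_eq
    simp
  constructor
  · intro c
    obtain ⟨a, f, hf, rfl⟩ := exists_eq_fracGerm M x c
    refine ⟨fracGerm M y f 1 (PrimeIdeal.one_notMem y),
      fracGerm M y a 1 (PrimeIdeal.one_notMem y), ?_, ?_⟩
    · rw [fracGerm_specializes M h _ _ _ (PrimeIdeal.one_notMem x)]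
      exact isUnit_germ f hf
    · rw [fracGerm_specializes M h _ _ _ (PrimeIdeal.one_notMem x),
        fracGerm_specializes M h _ _ _ (PrimeIdeal.one_notMem x), fracGerm_mul]
      apply fracGerm_eq
      simp [mul_comm]
  · intro s t hst
    obtain ⟨a, f, hf, rfl⟩ := exists_eq_fracGerm M y s
    obtain ⟨b, g, hg, rfl⟩ := exists_eq_fracGerm M y t
    rw [fracGerm_specializes M h _ _ _ (hle f hf), fracGerm_specializes M h _ _ _ (hle g hg)]
      at hst
    obtain ⟨W, hW, i, j, e⟩ := germ_eq _ x (hle f hf) (hle g hg) _ _ hst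
    have e' := congrFun (congrArg Subtype.val e) ⟨x, hW⟩
    obtain ⟨d, hd⟩ := Localization.r_iff_exists.1 (Localization.mk_eq_mk_iff.1 e')
    have hd' : d.1 * (g * a) = d.1 * (f * b) := hd
    have hdy : IsUnit (fracGerm M x d.1 1 (PrimeIdeal.one_notMem x)) := isUnit_germ d.1 d.2
    refine ⟨fracGerm M y d.1 1 (PrimeIdeal.one_notMem y), ?_, ?_⟩
    · rw [fracGerm_specializes M h _ _ _ (PrimeIdeal.one_notMem x)]
      exact hdy
    · rw [fracGerm_mul, fracGerm_mul]
      apply fracGerm_eq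
      rw [one_mul, one_mul, mul_left_comm, hd', mul_left_comm]

variable (X : MonoidScheme.{u})

lemma isLocalizing_specializes {x y : X.carrier} (h : x ⤳ y) :
    IsLocalizing (X.presheaf.stalkSpecializes h).hom := by
  obtain ⟨U, M, ⟨e⟩⟩ := X.local_affine y
  have hx : x ∈ U.1 := h.mem_open U.1.isOpen U.2
  let Y := X.toSheafedSpace.restrict U.isOpenEmbedding
  let x' : Y := (⟨x, hx⟩ : U.1)
  let y' : Y := (⟨y, U.2⟩ : U.1)
  have h' : x' ⤳ y' := (Topology.IsInducing.subtypeVal.specializes_iff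
    (x := (⟨x, hx⟩ : U.1)) (y := (⟨y, U.2⟩ : U.1))).1 h
  have := isLocalizing_of_stalkMap (X.toPresheafedSpace.ofRestrict U.isOpenEmbedding)
    (x := x') (y := y') h' h
  refine this.1 ?_
  refine (isLocalizing_of_stalkMap e.hom.hom h'
    (h'.map (ConcreteCategory.hom e.hom.hom.base).continuous)).2 ?_
  exact isLocalizing_spec M _

end Specialization
/-! ### Sections of the structure sheaf -/

namespace MonoidScheme

variable (X : MonoidScheme.{u})

/-- The monoid `O_X(U)`. -/
abbrev Sec (U : Opens X.carrier) : CommMonCat.{u} := X.presheaf.obj (op U)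

/-- The restriction map `O_X(U) → O_X(V)` for `V ⊆ U`. -/
def res {U V : Opens X.carrier} (h : V ≤ U) : X.Sec U →* X.Sec V :=
  (X.presheaf.map (homOfLE h).op).hom

/-- The stalk `O_{X,x}`. -/
abbrev Stalk (x : X.carrier) : CommMonCat.{u} := X.presheaf.stalk x

/-- The map `O_{X,p} → O_{X,q}` for `q ≤ p`, that is, for `p` in the closure of `q`. -/
def stalkRes {q p : X.carrier} (h : q ⤳ p) : X.Stalk p →* X.Stalk q :=
  (X.presheaf.stalkSpecializes h).hom

/-- `X` is `s`-cancellative if `O_{X,p}^* → O_{X,q}^*` is injective whenever `q ≤ p`. -/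
def IsSCancellative : Prop :=
  ∀ (q p : X.carrier) (h : q ⤳ p), Function.Injective (Units.map (X.stalkRes h))

/-! ### Semi-meromorphic functions and `s`-divisors -/

/-- The monoid `(O_{X,x})_{S(O_{X,x})}`. -/
abbrev SMerAt (x : X.carrier) : Type u := Localization (sRegular (X.Stalk x))

/-- The map `(O_{X,p})_{S(O_{X,p})} → (O_{X,q})_{S(O_{X,q})}` for `q ≤ p`. These maps make
`p ↦ (O_{X,p})_{S(O_{X,p})}` a contravariant functor on the points of `X`. -/
def sMerMap {q p : X.carrier} (h : q ⤳ p) : X.SMerAt p →* X.SMerAt q :=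
  sLocMap (X.stalkRes h) fun _ => (isLocalizing_specializes X h).map_isSRegular

/-- Families `(s x)` with `s x ∈ (O_{X,x})_{S(O_{X,x})}` compatible with the maps `sMerMap`. -/
def isCompatible : TopCat.LocalPredicate (X := X.carrier) X.SMerAt where
  pred {U} s := ∀ (q p : U) (h : q.1 ⤳ p.1), X.sMerMap h (s p) = s q
  res := fun i _ hs q p h => hs ⟨q.1, i.le q.2⟩ ⟨p.1, i.le p.2⟩ h
  locality := by
    intro U s hs q p h
    obtain ⟨V, hV, i, H⟩ := hs p
    exact H ⟨q.1, h.mem_open V.isOpen hV⟩ ⟨p.1, hV⟩ h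

/-- The sheaf `sM_X` of semi-meromorphic functions: the sheaf associated to the contravariant
functor `x ↦ (O_{X,x})_{S(O_{X,x})}` on the points, whose value on `U` is the limit of that functor
over `U`. -/
def sMer : TopCat.Sheaf CommMonCat.{u} X.carrier :=
  sheafOfFamilies X.SMerAt X.isCompatible (fun _ _ _ h => map_one (X.sMerMap h))
    (fun _ _ _ hf hg q p h =>
      (map_mul (X.sMerMap h) _ _).trans (congrArg₂ (· * ·) (hf q p h) (hg q p h)))

lemma sMerMap_monoidOf {q p : X.carrier} (h : q ⤳ p) (a : X.Stalk p) :
    X.sMerMap h (Localization.monoidOf _ a) = Localization.monoidOf _ (X.stalkRes h a) :=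
  Submonoid.LocalizationMap.lift_eq _ _ _

/-- The canonical map `O_X → sM_X`. -/
def toSMer : X.presheaf ⟶ X.sMer.presheaf where
  app U := CommMonCat.ofHom
    { toFun := fun a => ⟨fun x => Localization.monoidOf _ (X.presheaf.germ U.unop x.1 x.2 a),
        fun q p h => (X.sMerMap_monoidOf h _).trans
          (congrArg _ (TopCat.Presheaf.germ_stalkSpecializes_apply _ _ _ _))⟩
      map_one' := Subtype.ext (funext fun x => by
        simp only [map_one]; rfl)
      map_mul' := fun a b => Subtype.ext (funext fun x => by
        simp only [map_mul]; rfl) }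
  naturality U V i := by
    ext a
    refine Subtype.ext (funext fun x => congrArg (Localization.monoidOf _) ?_)
    exact TopCat.Presheaf.germ_res_apply _ i.unop x.1 x.2 a

/-- The group `sM_X^*(U)`. -/
abbrev SMerUnits (U : Opens X.carrier) : Type u := (X.sMer.presheaf.obj (op U))ˣ

/-- The restriction map `sM_X^*(U) → sM_X^*(V)` for `V ⊆ U`. -/
def sMerRes {U V : Opens X.carrier} (h : V ≤ U) : X.SMerUnits U →* X.SMerUnits V :=
  Units.map (X.sMer.presheaf.map (homOfLE h).op).hom

/-- The map `O_X^*(U) → sM_X^*(U)`. -/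
def unitsToSMer (U : Opens X.carrier) : (X.Sec U)ˣ →* X.SMerUnits U :=
  Units.map (X.toSMer.app (op U)).hom

/-- The map `O_{X,x}^* → (sM_X)_x^*` on stalks. -/
def stalkUnitsToSMer (x : X.carrier) : (X.Stalk x)ˣ →* (X.sMer.presheaf.stalk x : CommMonCat.{u})ˣ :=
  Units.map ((TopCat.Presheaf.stalkFunctor CommMonCat.{u} x).map X.toSMer).hom

/-- The stalk `(sM_X^* / O_X^*)_x`. -/
abbrev SDivAt (x : X.carrier) : Type u :=
  (X.sMer.presheaf.stalk x : CommMonCat.{u})ˣ ⧸ (X.stalkUnitsToSMer x).range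

/-- The class in `(sM_X^* / O_X^*)_x` of a section of `sM_X^*` near `x`. -/
def sDivGerm {U : Opens X.carrier} (x : X.carrier) (hx : x ∈ U) : X.SMerUnits U →* X.SDivAt x :=
  (QuotientGroup.mk' _).comp (Units.map (X.sMer.presheaf.germ U x hx).hom)

/-- The section `f` of `sM_X^*` over `U` represents over `U` the family `D` of elements of the
stalks of `sM_X^* / O_X^*`. -/
def Represents (D : ∀ x, X.SDivAt x) {U : Opens X.carrier} (f : X.SMerUnits U) : Prop :=
  ∀ (x : X.carrier) (hx : x ∈ U), D x = X.sDivGerm x hx f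

lemma sDivGerm_res {U V : Opens X.carrier} (h : V ≤ U) (x : X.carrier) (hx : x ∈ V)
    (f : X.SMerUnits U) : X.sDivGerm x hx (X.sMerRes h f) = X.sDivGerm x (h hx) f :=
  congrArg (QuotientGroup.mk' _) (Units.ext
    (TopCat.Presheaf.germ_res_apply X.sMer.presheaf (homOfLE h) x hx f.1))

lemma Represents.res {D : ∀ x, X.SDivAt x} {U V : Opens X.carrier} (h : V ≤ U)
    {f : X.SMerUnits U} (hf : X.Represents D f) : X.Represents D (X.sMerRes h f) :=
  fun x hx => (hf x (h hx)).trans (X.sDivGerm_res h x hx f).symm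

/-- The group of `s`-divisors: the global sections of the quotient sheaf `sM_X^* / O_X^*`, that is,
the families of elements of its stalks that are locally represented by sections of `sM_X^*`. -/
def SDivisor : Subgroup (∀ x, X.SDivAt x) where
  carrier := {D | ∀ x, ∃ U : Opens X.carrier, x ∈ U ∧ ∃ f : X.SMerUnits U, X.Represents D f}
  one_mem' := fun x => ⟨⊤, trivial, 1, fun y hy => (map_one (X.sDivGerm y hy)).symm⟩
  mul_mem' := by
    intro D E hD hE x
    obtain ⟨U, hU, f, hf⟩ := hD x
    obtain ⟨V, hV, g, hg⟩ := hE x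
    refine ⟨U ⊓ V, ⟨hU, hV⟩, X.sMerRes inf_le_left f * X.sMerRes inf_le_right g, fun y hy => ?_⟩
    rw [map_mul]
    exact congrArg₂ (· * ·) (hf.res X inf_le_left y hy) (hg.res X inf_le_right y hy)
  inv_mem' := by
    intro D hD x
    obtain ⟨U, hU, f, hf⟩ := hD x
    refine ⟨U, hU, f⁻¹, fun y hy => ?_⟩
    rw [map_inv]
    exact congrArg (·⁻¹) (hf y hy)

/-- The principal `s`-divisor of an element of `sM_X^*(X)`. -/
def principal : X.SMerUnits ⊤ →* X.SDivisor where
  toFun f := ⟨fun x => X.sDivGerm x (U := ⊤) trivial f, fun _ => ⟨⊤, trivial, f, fun _ _ => rfl⟩⟩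
  map_one' := Subtype.ext (funext fun x => map_one (X.sDivGerm x (U := ⊤) trivial))
  map_mul' f g := Subtype.ext (funext fun x => map_mul (X.sDivGerm x (U := ⊤) trivial) f g)

/-- The group `sCl(X)` of `s`-divisors modulo principal ones. -/
abbrev SCl : Type u := X.SDivisor ⧸ X.principal.range

end MonoidScheme
/-! ### Sheaves of sets with an action of the structure sheaf -/

/-- A presheaf of sets on `X` with an action of `O_X`. -/
structure OSet (X : MonoidScheme.{u}) where
  presheaf : TopCat.Presheaf (Type u) X.carrier
  act : ∀ U : Opens X.carrier, MulAction (X.Sec U) (presheaf.obj (op U))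
  map_smul : ∀ {U V : Opens X.carrier} (h : V ≤ U) (a : X.Sec U) (s : presheaf.obj (op U)),
    presheaf.map (homOfLE h).op (a • s) = X.res h a • presheaf.map (homOfLE h).op s

namespace OSet

variable {X : MonoidScheme.{u}} (L L' : OSet X)

/-- The set `L(U)`. -/
def Sec (U : Opens X.carrier) : Type u := L.presheaf.obj (op U)

instance (U : Opens X.carrier) : MulAction (X.Sec U) (L.Sec U) := L.act U

/-- The restriction map `L(U) → L(V)` for `V ⊆ U`. -/
def res {U V : Opens X.carrier} (h : V ≤ U) (s : L.Sec U) : L.Sec V :=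
  L.presheaf.map (homOfLE h).op s

/-- An isomorphism `L|_U ≅ L'|_U` of presheaves of sets with an action of `O_U`. -/
structure IsoOn (U : Opens X.carrier) where
  equiv : ∀ V : Opens X.carrier, V ≤ U → (L.Sec V ≃ L'.Sec V)
  map_smul : ∀ (V : Opens X.carrier) (hV : V ≤ U) (a : X.Sec V) (s : L.Sec V),
    equiv V hV (a • s) = a • equiv V hV s
  map_res : ∀ (V W : Opens X.carrier) (hV : V ≤ U) (hW : W ≤ V) (s : L.Sec V),
    equiv W (hW.trans hV) (L.res hW s) = L'.res hW (equiv V hV s)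

variable (X) in
/-- The sheaf `O_X`, acting on itself. -/
def structureSet : OSet X where
  presheaf := X.presheaf ⋙ forget CommMonCat.{u}
  act U := (inferInstance : MulAction (X.Sec U) (X.Sec U))
  map_smul h a s := map_mul (X.res h) a s

end OSet

/-- A line bundle on `X`: a sheaf of sets with an action of `O_X` that is locally isomorphic
to `O_X`. -/
structure LineBundle (X : MonoidScheme.{u}) extends OSet X where
  isSheaf : presheaf.IsSheaf
  locally_trivial : ∀ x : X.carrier, ∃ U : Opens X.carrier, x ∈ U ∧
    Nonempty ((OSet.structureSet X).IsoOn toOSet U)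

section Frames

variable {X : MonoidScheme.{u}}

lemma MonoidScheme.res_res {U V W : Opens X.carrier} (h : V ≤ U) (h' : W ≤ V) (a : X.Sec U) :
    X.res h' (X.res h a) = X.res (h'.trans h) a := by
  have := X.presheaf.map_comp (homOfLE h).op (homOfLE h').op
  exact (ConcreteCategory.congr_hom this a).symm

lemma MonoidScheme.res_refl {U : Opens X.carrier} (a : X.Sec U) : X.res le_rfl a = a :=
  ConcreteCategory.congr_hom (X.presheaf.map_id (op U)) a

namespace OSet

variable {L : OSet X}

lemma res_res {U V W : Opens X.carrier} (h : V ≤ U) (h' : W ≤ V) (s : L.Sec U) :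
    L.res h' (L.res h s) = L.res (h'.trans h) s := by
  have := L.presheaf.map_comp (homOfLE h).op (homOfLE h').op
  exact (ConcreteCategory.congr_hom this s).symm

lemma res_refl {U : Opens X.carrier} (s : L.Sec U) : L.res le_rfl s = s :=
  ConcreteCategory.congr_hom (L.presheaf.map_id (op U)) s

lemma res_smul {U V : Opens X.carrier} (h : V ≤ U) (a : X.Sec U) (s : L.Sec U) :
    L.res h (a • s) = X.res h a • L.res h s := L.map_smul h a s

/-- A section `e` over `U` is a frame if multiplication by `e` is an isomorphism
`O_X|_U ≅ L|_U`. -/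
def IsFrame {U : Opens X.carrier} (e : L.Sec U) : Prop :=
  ∀ (V : Opens X.carrier) (h : V ≤ U), Function.Bijective fun a : X.Sec V => a • L.res h e

lemma IsFrame.res {U V : Opens X.carrier} {e : L.Sec U} (he : IsFrame e) (h : V ≤ U) :
    IsFrame (L.res h e) := fun W hW => by
  simp only [res_res]; exact he W _

lemma IsFrame.exists_smul {U V : Opens X.carrier} {e : L.Sec U} (he : IsFrame e) (h : V ≤ U)
    (s : L.Sec V) : ∃ a : X.Sec V, s = a • L.res h e :=
  ((he V h).2 s).imp fun _ => Eq.symm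

lemma IsFrame.smul_cancel {U V : Opens X.carrier} {e : L.Sec U} (he : IsFrame e) (h : V ≤ U)
    {a b : X.Sec V} (hab : a • L.res h e = b • L.res h e) : a = b := (he V h).1 hab

/-- Multiplication by a frame. -/
def IsFrame.isoOn {U : Opens X.carrier} {e : L.Sec U} (he : IsFrame e) :
    (structureSet X).IsoOn L U where
  equiv V h := Equiv.ofBijective (fun a : X.Sec V => a • L.res h e) (he V h)
  map_smul V h a s := mul_smul (α := X.Sec V) a s _
  map_res V W hV hW s := by
    change X.res hW s • L.res _ e = L.res hW ((show X.Sec V from s) • L.res hV e)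
    rw [res_smul, res_res]

lemma IsoOn.isFrame {U : Opens X.carrier} (i : (structureSet X).IsoOn L U) :
    IsFrame (i.equiv U le_rfl (1 : X.Sec U)) := by
  intro V h
  suffices key : (fun a : X.Sec V => a • L.res h (i.equiv U le_rfl (1 : X.Sec U))) = i.equiv V h by
    rw [key]
    exact (i.equiv V h).bijective
  funext a
  refine (congrArg (fun t => a • t) (i.map_res U V le_rfl h (1 : X.Sec U)).symm).trans
    ((i.map_smul V h a _).symm.trans (congrArg (i.equiv V h) ?_))
  change (a : X.Sec V) * X.res h 1 = a
  rw [map_one, mul_one]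

lemma ext_local (hL : L.presheaf.IsSheaf) {U : Opens X.carrier} {s t : L.Sec U}
    (h : ∀ x ∈ U, ∃ (V : Opens X.carrier) (hV : V ≤ U), x ∈ V ∧ L.res hV s = L.res hV t) :
    s = t := by
  choose V hV hx hst using h
  refine TopCat.Sheaf.eq_of_locally_eq' ⟨L.presheaf, hL⟩ (fun x : U => V x.1 x.2) U
    (fun x => homOfLE (hV x.1 x.2)) (fun x hxU => ?_) s t (fun x => hst x.1 x.2)
  exact Opens.mem_iSup.2 ⟨⟨x, hxU⟩, hx x hxU⟩

lemma glue (hL : L.presheaf.IsSheaf) {U : Opens X.carrier}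
    (P : ∀ V : Opens X.carrier, L.Sec V → Prop)
    (ex : ∀ x ∈ U, ∃ V : Opens X.carrier, V ≤ U ∧ x ∈ V ∧ ∃ t : L.Sec V, P V t)
    (compat : ∀ (V V' : Opens X.carrier) (t : L.Sec V) (t' : L.Sec V'), P V t → P V' t' →
      ∀ (W : Opens X.carrier) (h : W ≤ V) (h' : W ≤ V'), L.res h t = L.res h' t') :
    ∃ s : L.Sec U, ∀ (V : Opens X.carrier) (h : V ≤ U) (t : L.Sec V), P V t → L.res h s = t := by
  choose V hV hx t ht using ex
  have hglue := TopCat.Sheaf.existsUnique_gluing' ⟨L.presheaf, hL⟩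
    (fun x : U => V x.1 x.2) U (fun x => homOfLE (hV x.1 x.2))
    (fun x hxU => Opens.mem_iSup.2 ⟨⟨x, hxU⟩, hx x hxU⟩) (fun x => t x.1 x.2)
    (by intro x y; exact compat _ _ _ _ (ht x.1 x.2) (ht y.1 y.2) _ inf_le_left inf_le_right)
  obtain ⟨(s : L.Sec U), hs, -⟩ := hglue
  refine ⟨s, fun W hW t' ht' => ext_local hL fun x hxW => ?_⟩
  refine ⟨W ⊓ V x (hW hxW), inf_le_left, ⟨hxW, hx x _⟩, ?_⟩
  have h1 : L.res (hV x (hW hxW)) s = t x (hW hxW) := hs ⟨x, hW hxW⟩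
  rw [res_res, compat _ _ _ _ ht' (ht x (hW hxW)) _ inf_le_left inf_le_right, ← h1, res_res]

variable (X) in
lemma structureSet_isSheaf : (structureSet X).presheaf.IsSheaf :=
  (TopCat.Presheaf.isSheaf_iff_isSheaf_comp (forget CommMonCat.{u}) X.presheaf).1 X.IsSheaf

lemma sec_ext {U : Opens X.carrier} {a b : X.Sec U}
    (h : ∀ x ∈ U, ∃ (V : Opens X.carrier) (hV : V ≤ U), x ∈ V ∧ X.res hV a = X.res hV b) :
    a = b :=
  ext_local (L := structureSet X) (structureSet_isSheaf X) h

lemma sec_glue {U : Opens X.carrier} (P : ∀ V : Opens X.carrier, X.Sec V → Prop)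
    (ex : ∀ x ∈ U, ∃ V : Opens X.carrier, V ≤ U ∧ x ∈ V ∧ ∃ t : X.Sec V, P V t)
    (compat : ∀ (V V' : Opens X.carrier) (t : X.Sec V) (t' : X.Sec V'), P V t → P V' t' →
      ∀ (W : Opens X.carrier) (h : W ≤ V) (h' : W ≤ V'), X.res h t = X.res h' t') :
    ∃ s : X.Sec U, ∀ (V : Opens X.carrier) (h : V ≤ U) (t : X.Sec V), P V t → X.res h s = t :=
  glue (L := structureSet X) (structureSet_isSheaf X) P ex compat

variable (X) in
lemma isFrame_one (U : Opens X.carrier) : IsFrame (L := structureSet X) (U := U) (1 : X.Sec U) := by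
  intro V h
  suffices key : (fun a : X.Sec V => a • (structureSet X).res h (1 : X.Sec U)) = id by
    rw [key]
    exact Function.bijective_id
  funext a
  change (a : X.Sec V) * X.res h 1 = a
  rw [map_one, mul_one]

end OSet

namespace LineBundle

open OSet

lemma exists_frame (L : LineBundle X) (x : X.carrier) :
    ∃ U : Opens X.carrier, x ∈ U ∧ ∃ e : L.Sec U, IsFrame e := by
  obtain ⟨U, hU, ⟨i⟩⟩ := L.locally_trivial x
  exact ⟨U, hU, _, i.isFrame⟩

variable (X) in
/-- The trivial line bundle `O_X`. -/
def trivial : LineBundle X where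
  toOSet := structureSet X
  isSheaf := structureSet_isSheaf X
  locally_trivial _ := ⟨⊤, _root_.trivial, ⟨(isFrame_one X ⊤).isoOn⟩⟩

/-- Line bundles are isomorphic if they are so as sheaves of sets with an action of `O_X`. -/
def Iso (L L' : LineBundle X) : Prop := Nonempty (L.toOSet.IsoOn L'.toOSet ⊤)

lemma Iso.refl (L : LineBundle X) : Iso L L :=
  ⟨⟨fun _ _ => Equiv.refl _, fun _ _ _ _ => rfl, fun _ _ _ _ _ => rfl⟩⟩

lemma Iso.symm {L L' : LineBundle X} : Iso L L' → Iso L' L := fun ⟨i⟩ =>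
  ⟨⟨fun V h => (i.equiv V h).symm,
    fun V h a s => by rw [Equiv.symm_apply_eq, i.map_smul, Equiv.apply_symm_apply],
    fun V W hV hW s => by rw [Equiv.symm_apply_eq, i.map_res _ _ hV hW, Equiv.apply_symm_apply]⟩⟩

lemma Iso.trans {L L' L'' : LineBundle X} : Iso L L' → Iso L' L'' → Iso L L'' := fun ⟨i⟩ ⟨j⟩ =>
  ⟨⟨fun V h => (i.equiv V h).trans (j.equiv V h),
    fun V h a s => by simp only [Equiv.trans_apply, i.map_smul, j.map_smul],
    fun V W hV hW s => by simp only [Equiv.trans_apply, i.map_res _ _ hV hW, j.map_res _ _ hV hW]⟩⟩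

variable (X) in
/-- Isomorphism as an equivalence relation. -/
def isoSetoid : Setoid (LineBundle X) := ⟨Iso, Iso.refl, Iso.symm, Iso.trans⟩

/-- Auxiliary: `R` matches frames of `N` with frames of `N'`, in such a way that there are matched
frames near every point, with the same coordinate changes. -/
structure FrameMatch {N N' : LineBundle X}
    (R : ∀ U : Opens X.carrier, N.Sec U → N'.Sec U → Prop) : Prop where
  frame : ∀ U e e', R U e e' → IsFrame e ∧ IsFrame e'
  cover : ∀ x : X.carrier, ∃ U, x ∈ U ∧ ∃ e e', R U e e'
  compat : ∀ U e e' V f f', R U e e' → R V f f' →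
    ∀ (W : Opens X.carrier) (hU : W ≤ U) (hV : W ≤ V) (a : X.Sec W),
      N.res hU e = a • N.res hV f → N'.res hU e' = a • N'.res hV f'

section
variable {N N' : LineBundle X} {R : ∀ U : Opens X.carrier, N.Sec U → N'.Sec U → Prop}

lemma FrameMatch.symm (H : FrameMatch R) : FrameMatch fun U e' e => R U e e' where
  frame U e' e h := (H.frame U e e' h).symm
  cover x := by
    obtain ⟨U, hx, e, e', h⟩ := H.cover x
    exact ⟨U, hx, e', e, h⟩
  compat := by
    intro U e' e V f' f h k W hU hV a ha
    obtain ⟨b, hb⟩ := (H.frame V f f' k).1.exists_smul hV (N.res hU e)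
    rw [H.compat _ _ _ _ _ _ h k W hU hV b hb] at ha
    rw [hb, (H.frame V f f' k).2.smul_cancel hV ha]

variable (R) in
/-- Auxiliary: `s` and `s'` have the same coordinates in matched frames. -/
def SameCoord {V : Opens X.carrier} (s : N.Sec V) (s' : N'.Sec V) : Prop :=
  ∀ (U : Opens X.carrier) (e : N.Sec U) (e' : N'.Sec U), R U e e' →
    ∀ (W : Opens X.carrier) (hU : W ≤ U) (hV : W ≤ V) (a : X.Sec W),
      N.res hV s = a • N.res hU e → N'.res hV s' = a • N'.res hU e'

lemma FrameMatch.existsUnique (H : FrameMatch R) {V : Opens X.carrier} (s : N.Sec V) :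
    ∃! s' : N'.Sec V, SameCoord R s s' := by
  refine existsUnique_of_exists_of_unique ?_ ?_
  · suffices h : ∃ s' : N'.Sec V, ∀ (W : Opens X.carrier) (h : W ≤ V) (t : N'.Sec W),
        (∃ U e e', R U e e' ∧ ∃ (hU : W ≤ U) (hV : W ≤ V) (a : X.Sec W),
          N.res hV s = a • N.res hU e ∧ t = a • N'.res hU e') → N'.res h s' = t by
      obtain ⟨s', hs'⟩ := h
      exact ⟨s', fun U e e' h W hU hV a ha => hs' W hV _ ⟨U, e, e', h, hU, hV, a, ha, rfl⟩⟩
    apply OSet.glue N'.isSheaf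
    · intro x hx
      obtain ⟨U, hxU, e, e', h⟩ := H.cover x
      obtain ⟨a, ha⟩ := (H.frame U e e' h).1.exists_smul (V := U ⊓ V) inf_le_left
        (N.res inf_le_right s)
      exact ⟨U ⊓ V, inf_le_right, ⟨hxU, hx⟩, _, U, e, e', h, inf_le_left, inf_le_right, a, ha, rfl⟩
    · rintro W W' t t' ⟨U, e, e', h, hU, hV, a, ha, rfl⟩ ⟨U', f, f', h', hU', hV', b, hb, rfl⟩ T hT
        hT'
      obtain ⟨c, hc⟩ := (H.frame _ _ _ h').1.exists_smul (hT'.trans hU') (N.res (hT.trans hU) e)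
      have hc' := H.compat _ _ _ _ _ _ h h' T (hT.trans hU) (hT'.trans hU') c hc
      have e1 := congrArg (N.res hT) ha
      have e2 := congrArg (N.res hT') hb
      rw [res_smul, res_res, res_res] at e1 e2
      have key : X.res hT a * c = X.res hT' b :=
        (H.frame _ _ _ h').1.smul_cancel (hT'.trans hU') (by
          rw [mul_smul, ← hc, ← e1, ← e2])
      rw [res_smul, res_smul, res_res, res_res, hc', ← mul_smul, key]
  · intro s₁ s₂ h₁ h₂
    refine ext_local N'.isSheaf fun x hx => ?_
    obtain ⟨U, hxU, e, e', h⟩ := H.cover x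
    obtain ⟨a, ha⟩ := (H.frame U e e' h).1.exists_smul (V := U ⊓ V) inf_le_left
      (N.res inf_le_right s)
    exact ⟨U ⊓ V, inf_le_right, ⟨hxU, hx⟩, (h₁ _ _ _ h _ _ _ a ha).trans
      (h₂ _ _ _ h _ _ _ a ha).symm⟩

lemma FrameMatch.swap (H : FrameMatch R) {V : Opens X.carrier} {s : N.Sec V} {s' : N'.Sec V}
    (h : SameCoord R s s') : SameCoord (fun U e' e => R U e e') s' s := by
  intro U e' e hR W hU hV a ha
  obtain ⟨b, hb⟩ := (H.frame U e e' hR).1.exists_smul hU (N.res hV s)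
  rw [h U e e' hR W hU hV b hb] at ha
  rw [hb, (H.frame U e e' hR).2.smul_cancel hU ha]

lemma FrameMatch.iso (H : FrameMatch R) : Iso N N' := by
  have A := fun (V : Opens X.carrier) (s : N.Sec V) => H.existsUnique s
  have B := fun (V : Opens X.carrier) (s' : N'.Sec V) => H.symm.existsUnique s'
  choose F hF hF' using A
  choose G hG hG' using B
  refine ⟨⟨fun V _ => ⟨F V, G V, fun s => ?_, fun s => ?_⟩, fun V hV a s => ?_,
    fun V W hV hW s => ?_⟩⟩
  · exact (hG' V _ s (H.swap (hF V s))).symm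
  · exact (hF' V _ s (H.symm.swap (hG V s))).symm
  · refine (hF' V _ _ fun U e e' h W hU hVW b hb => ?_).symm
    obtain ⟨c, hc⟩ := (H.frame U e e' h).1.exists_smul hU (N.res hVW s)
    rw [res_smul, hc, ← mul_smul] at hb
    have := hF V s U e e' h W hU hVW c hc
    dsimp only [Equiv.coe_fn_mk]
    rw [res_smul, this, ← mul_smul, (H.frame U e e' h).1.smul_cancel hU hb]
  · refine (hF' W _ _ fun U e e' h T hU hTW b hb => ?_).symm
    dsimp only [Equiv.coe_fn_mk]
    rw [res_res] at hb ⊢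
    exact hF V s U e e' h T hU _ b hb

end

end LineBundle

end Frames
/-! ### Tensor products -/

section MTensor

variable (M S T : Type u) [CommMonoid M] [MulAction M S] [MulAction M T]

/-- The relation `(m s, t) ∼ (s, m t)` on `S × T`. -/
def MTensor.Rel (p q : S × T) : Prop := ∃ (m : M) (s : S) (t : T), p = (m • s, t) ∧ q = (s, m • t)

/-- The tensor product `S ⊗_M T` of two `M`-sets: the quotient of `S × T` by the equivalence
relation generated by `(m s, t) ∼ (s, m t)`. -/
def MTensor : Type u := Quot (MTensor.Rel M S T)

variable {S T}

/-- The element `s ⊗ t`. -/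
def MTensor.mk (s : S) (t : T) : MTensor M S T := Quot.mk _ (s, t)

lemma MTensor.smul_mk_eq (m : M) (s : S) (t : T) :
    MTensor.mk M (m • s) t = MTensor.mk M s (m • t) :=
  Quot.sound ⟨m, s, t, rfl, rfl⟩

variable (S T)

/-- The action `m (s ⊗ t) = m s ⊗ t`. -/
instance : MulAction M (MTensor M S T) where
  smul m := Quot.map (fun p => (m • p.1, p.2)) (by
    rintro _ _ ⟨n, s, t, rfl, rfl⟩
    exact ⟨n, m • s, t, by simp [smul_comm m n s], rfl⟩)
  one_smul := by
    rintro ⟨s, t⟩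
    exact congrArg (MTensor.mk M · t) (one_smul M s)
  mul_smul := by
    rintro m n ⟨s, t⟩
    exact congrArg (MTensor.mk M · t) (mul_smul m n s)

variable {S T}

lemma MTensor.smul_mk (m : M) (s : S) (t : T) : m • MTensor.mk M s t = MTensor.mk M (m • s) t := rfl

end MTensor

namespace OSet

variable {X : MonoidScheme.{u}}

/-- The presheaf `U ↦ L(U) ⊗_{O_X(U)} L'(U)`. -/
def tensorPresheaf (L L' : OSet X) : OSet X where
  presheaf :=
    { obj := fun U => MTensor (X.Sec U.unop) (L.Sec U.unop) (L'.Sec U.unop)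
      map := fun {U V} i => ↾(Quot.map (fun p => (L.res i.unop.le p.1, L'.res i.unop.le p.2)) (by
        rintro _ _ ⟨m, s, t, rfl, rfl⟩
        exact ⟨X.res i.unop.le m, L.res i.unop.le s, L'.res i.unop.le t,
          by rw [res_smul], by rw [res_smul]⟩))
      map_id := fun U => by
        ext p
        obtain ⟨s, t⟩ := p
        exact congrArg₂ (MTensor.mk _) (res_refl s) (res_refl t)
      map_comp := fun i j => by
        ext p
        obtain ⟨s, t⟩ := p
        exact congrArg₂ (MTensor.mk _) (res_res i.unop.le j.unop.le s).symm
          (res_res i.unop.le j.unop.le t).symm }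
  act U := (inferInstance : MulAction (X.Sec U) (MTensor (X.Sec U) (L.Sec U) (L'.Sec U)))
  map_smul {U V} h a p := by
    obtain ⟨s, t⟩ := p
    exact congrArg (MTensor.mk _ · (L'.res h t)) (res_smul h a s)

section Sheafify

variable (P : OSet X)

/-- The germ at `x` of a section. -/
def germ {x : X.carrier} {U : Opens X.carrier} (hx : x ∈ U) (s : P.Sec U) : P.presheaf.stalk x :=
  P.presheaf.germ U x hx s

lemma exists_germ {x : X.carrier} (t : P.presheaf.stalk x) :
    ∃ (U : Opens X.carrier) (hx : x ∈ U) (s : P.Sec U), P.germ hx s = t :=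
  TopCat.Presheaf.exists_germ_eq P.presheaf t

lemma germ_res {x : X.carrier} {U V : Opens X.carrier} (h : V ≤ U) (hx : x ∈ V) (s : P.Sec U) :
    P.germ hx (P.res h s) = P.germ (h hx) s :=
  TopCat.Presheaf.germ_res_apply P.presheaf (homOfLE h) x hx s

lemma germ_eq {x : X.carrier} {U V : Opens X.carrier} (hU : x ∈ U) (hV : x ∈ V) (s : P.Sec U)
    (t : P.Sec V) (h : P.germ hU s = P.germ hV t) :
    ∃ (W : Opens X.carrier) (_ : x ∈ W) (h : W ≤ U) (h' : W ≤ V), P.res h s = P.res h' t := by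
  obtain ⟨W, hW, i, j, e⟩ := TopCat.Presheaf.germ_eq P.presheaf x hU hV s t h
  exact ⟨W, hW, i.le, j.le, e⟩

/-- The action on the stalk at `x` of an element of `O_X(U)` with `x ∈ U`: the germ of `s` is sent
to the germ of `a s`. -/
def stalkSMul {x : X.carrier} {U : Opens X.carrier} (hx : x ∈ U) (a : X.Sec U)
    (t : P.presheaf.stalk x) : P.presheaf.stalk x :=
  let h := P.exists_germ t
  P.germ (U := U ⊓ h.choose) (Opens.mem_inf.2 ⟨hx, h.choose_spec.choose⟩)
    (X.res (V := U ⊓ h.choose) inf_le_left a •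
      P.res (V := U ⊓ h.choose) inf_le_right h.choose_spec.choose_spec.choose)

lemma stalkSMul_germ {x : X.carrier} {U V : Opens X.carrier} (hU : x ∈ U) (hV : x ∈ V)
    (a : X.Sec U) (s : P.Sec V) :
    P.stalkSMul hU a (P.germ hV s) =
      P.germ (U := U ⊓ V) (Opens.mem_inf.2 ⟨hU, hV⟩)
        (X.res (V := U ⊓ V) inf_le_left a • P.res (V := U ⊓ V) inf_le_right s) := by
  have h := P.exists_germ (P.germ hV s)
  have h' : P.germ h.choose_spec.choose h.choose_spec.choose_spec.choose =
    P.germ hV s := h.choose_spec.choose_spec.choose_spec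
  obtain ⟨W, hW, i, j, e⟩ := P.germ_eq _ _ _ _ h'
  change P.germ (U := U ⊓ h.choose) _ _ = _
  rw [← P.germ_res (V := U ⊓ W) (inf_le_inf_left U i) ⟨hU, hW⟩,
    ← P.germ_res (V := U ⊓ W) (inf_le_inf_left U j) ⟨hU, hW⟩]
  congr 1
  rw [res_smul, res_smul, res_res, res_res, MonoidScheme.res_res, MonoidScheme.res_res,
    ← res_res i inf_le_right, ← res_res j inf_le_right, e]

lemma stalkSMul_germ_same {x : X.carrier} {U V : Opens X.carrier} (hV : x ∈ V) (h : V ≤ U)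
    (a : X.Sec U) (s : P.Sec V) :
    P.stalkSMul (h hV) a (P.germ hV s) = P.germ hV (X.res h a • s) := by
  rw [stalkSMul_germ, ← P.germ_res (V := V) (le_inf h le_rfl) hV, res_smul, res_res,
    MonoidScheme.res_res, res_refl]

lemma stalkSMul_one {x : X.carrier} {U : Opens X.carrier} (hU : x ∈ U) (t : P.presheaf.stalk x) :
    P.stalkSMul hU (1 : X.Sec U) t = t := by
  obtain ⟨V, hV, s, rfl⟩ := P.exists_germ t
  rw [stalkSMul_germ, map_one, one_smul, germ_res]

lemma stalkSMul_mul {x : X.carrier} {U : Opens X.carrier} (hU : x ∈ U) (a b : X.Sec U)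
    (t : P.presheaf.stalk x) :
    P.stalkSMul hU (a * b) t = P.stalkSMul hU a (P.stalkSMul hU b t) := by
  obtain ⟨V, hV, s, rfl⟩ := P.exists_germ t
  rw [stalkSMul_germ, stalkSMul_germ, stalkSMul_germ_same (U := U) (h := inf_le_left),
    map_mul, mul_smul]

lemma stalkSMul_res {x : X.carrier} {U V : Opens X.carrier} (h : V ≤ U) (hV : x ∈ V) (a : X.Sec U)
    (t : P.presheaf.stalk x) : P.stalkSMul (h hV) a t = P.stalkSMul hV (X.res h a) t := by
  obtain ⟨W, hW, s, rfl⟩ := P.exists_germ t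
  rw [stalkSMul_germ, stalkSMul_germ, ← P.germ_res (V := V ⊓ W) (inf_le_inf_right W h) ⟨hV, hW⟩,
    res_smul, res_res, MonoidScheme.res_res, MonoidScheme.res_res]

/-- The sheaf associated to a presheaf of sets with an action of `O_X`. -/
def sheafify : OSet X where
  presheaf := P.presheaf.sheafify.presheaf
  act U :=
    { smul := fun a f => ⟨fun x => P.stalkSMul x.2 a (f.1 x), fun x => by
        obtain ⟨V, hV, i, g, hg⟩ := f.2 x
        refine ⟨V, hV, i, (show P.Sec V from X.res i.le a • (show P.Sec V from g)), fun y => ?_⟩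
        have hy : f.1 (i y) = P.germ y.2 (show P.Sec V from g) := hg y
        exact (congrArg (P.stalkSMul (i y).2 a) hy).trans (P.stalkSMul_germ_same y.2 i.le a g)⟩
      one_smul := fun f => Subtype.ext (funext fun x => P.stalkSMul_one x.2 (f.1 x))
      mul_smul := fun a b f => Subtype.ext (funext fun x => P.stalkSMul_mul x.2 a b (f.1 x)) }
  map_smul h a f := Subtype.ext (funext fun x => P.stalkSMul_res h x.2 a (f.1 ⟨x.1, h x.2⟩))

/-- The canonical map from a presheaf to the associated sheaf. -/
def unit {U : Opens X.carrier} (s : P.Sec U) : P.sheafify.Sec U :=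
  P.presheaf.toSheafify.app (op U) s

lemma unit_res {U V : Opens X.carrier} (h : V ≤ U) (s : P.Sec U) :
    P.unit (P.res h s) = P.sheafify.res h (P.unit s) :=
  Subtype.ext (funext fun x => P.germ_res h x.2 s)

lemma unit_smul {U : Opens X.carrier} (a : X.Sec U) (s : P.Sec U) :
    P.unit (a • s) = a • P.unit s := by
  refine Subtype.ext (funext fun x => ?_)
  refine Eq.trans ?_ (P.stalkSMul_germ_same x.2 le_rfl a s).symm
  rw [MonoidScheme.res_refl]
  rfl

lemma IsFrame.unit {P : OSet X} {U : Opens X.carrier} {e : P.Sec U} (he : IsFrame e) :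
    IsFrame (P.unit e) := by
  have inj : ∀ {V : Opens X.carrier} (h : V ≤ U) {a b : X.Sec V},
      P.unit (a • P.res h e) = P.unit (b • P.res h e) → a = b := by
    intro V h a b hab
    refine sec_ext fun x hx => ?_
    have hg : P.germ hx (a • P.res h e) = P.germ hx (b • P.res h e) :=
      congrFun (congrArg Subtype.val hab) ⟨x, hx⟩
    obtain ⟨W, hW, i, j, hw⟩ := P.germ_eq _ _ _ _ hg
    rw [res_smul, res_smul, res_res] at hw
    exact ⟨W, i, hW, he.smul_cancel (i.trans h) hw⟩
  intro V h
  simp only [← unit_res, ← unit_smul]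
  refine ⟨fun a b hab => inj h hab, ?_⟩
  · intro f
    have cover : ∀ x ∈ V, ∃ W : Opens X.carrier, W ≤ V ∧ x ∈ W ∧ ∃ t : X.Sec W,
        ∃ hW : W ≤ V, P.unit (t • P.res (hW.trans h) e) =
          P.sheafify.res hW f := by
      intro x hx
      obtain ⟨W, hW, i, g, hg⟩ := f.2 ⟨x, hx⟩
      obtain ⟨a, ha⟩ := he.exists_smul (i.le.trans h) (show P.Sec W from g)
      refine ⟨W, i.le, hW, a, i.le, ?_⟩
      exact (congrArg P.unit ha.symm).trans (Subtype.ext (funext fun y => (hg y).symm))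
    obtain ⟨a, ha⟩ := sec_glue (U := V)
      (fun W t => ∃ hW : W ≤ V, P.unit (t • P.res (hW.trans h) e) =
        P.sheafify.res hW f) cover (by
        rintro W W' t t' ⟨hW, ht⟩ ⟨hW', ht'⟩ T hT hT'
        have e1 := congrArg (P.sheafify.res hT) ht
        have e2 := congrArg (P.sheafify.res hT') ht'
        rw [← unit_res, res_smul, res_res, res_res] at e1 e2
        exact inj ((hT.trans hW).trans h) (e1.trans e2.symm))
    refine ⟨a, ext_local (L := P.sheafify) P.presheaf.sheafify.property fun x hx => ?_⟩
    obtain ⟨W, hW, hxW, t, hW', ht⟩ := cover x hx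
    refine ⟨W, hW, hxW, ?_⟩
    have hat : X.res hW a = t := ha W hW t ⟨hW', ht⟩
    dsimp only
    rw [← ht, ← unit_res, res_smul, res_res, hat]

end Sheafify

end OSet
namespace OSet

variable {X : MonoidScheme.{u}} {L L' : OSet X}

/-- The section `s ⊗ t` of the presheaf tensor product. -/
def pmul {U : Opens X.carrier} (s : L.Sec U) (t : L'.Sec U) : (tensorPresheaf L L').Sec U :=
  MTensor.mk (X.Sec U) s t

lemma pmul_res {U V : Opens X.carrier} (h : V ≤ U) (s : L.Sec U) (t : L'.Sec U) :
    (tensorPresheaf L L').res h (pmul s t) = pmul (L.res h s) (L'.res h t) := rfl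

lemma smul_pmul {U : Opens X.carrier} (a : X.Sec U) (s : L.Sec U) (t : L'.Sec U) :
    a • pmul s t = pmul (a • s) t := rfl

lemma pmul_smul {U : Opens X.carrier} (a : X.Sec U) (s : L.Sec U) (t : L'.Sec U) :
    pmul s (a • t) = a • pmul s t := (MTensor.smul_mk_eq (X.Sec U) a s t).symm

lemma IsFrame.pmul {U : Opens X.carrier} {e : L.Sec U} {f : L'.Sec U} (he : IsFrame e)
    (hf : IsFrame f) : IsFrame (pmul e f) := by
  intro V h
  have hc : ∀ s : L.Sec V, ∃ a : X.Sec V, s = a • L.res h e := fun s => he.exists_smul h s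
  have hd : ∀ t : L'.Sec V, ∃ a : X.Sec V, t = a • L'.res h f := fun t => hf.exists_smul h t
  choose c hc using hc
  choose d hd using hd
  have c_smul : ∀ (a : X.Sec V) s, c (a • s) = a * c s := fun a s =>
    he.smul_cancel h (by rw [← hc, mul_smul, ← hc])
  have d_smul : ∀ (a : X.Sec V) t, d (a • t) = a * d t := fun a t =>
    hf.smul_cancel h (by rw [← hd, mul_smul, ← hd])
  have c_one : c (L.res h e) = 1 := he.smul_cancel h (by rw [← hc, one_smul])
  have d_one : d (L'.res h f) = 1 := hf.smul_cancel h (by rw [← hd, one_smul])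
  let q : MTensor (X.Sec V) (L.Sec V) (L'.Sec V) → X.Sec V :=
    Quot.lift (fun p => c p.1 * d p.2) (by
      rintro _ _ ⟨m, s, t, rfl, rfl⟩
      simp only [c_smul, d_smul]
      ac_rfl)
  have q_smul : ∀ a : X.Sec V, q (a • OSet.pmul (L.res h e) (L'.res h f)) = a := fun a => by
    change c (a • L.res h e) * d (L'.res h f) = a
    rw [c_smul, c_one, d_one, mul_one, mul_one]
  refine ⟨fun a b hab => ?_, ?_⟩
  · rw [← q_smul a, ← q_smul b]
    exact congrArg q hab
  · rintro ⟨s, t⟩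
    refine ⟨d t * c s, ?_⟩
    change (d t * c s) • OSet.pmul (L.res h e) (L'.res h f) = OSet.pmul s t
    rw [mul_smul, smul_pmul, ← hc, ← pmul_smul, ← hd]

end OSet

namespace LineBundle

open OSet

variable {X : MonoidScheme.{u}}

/-- The tensor product of line bundles: the sheaf associated to
`U ↦ L(U) ⊗_{O_X(U)} L'(U)`. -/
def tensor (L L' : LineBundle X) : LineBundle X where
  toOSet := (tensorPresheaf L.toOSet L'.toOSet).sheafify
  isSheaf := (tensorPresheaf L.toOSet L'.toOSet).presheaf.sheafify.property
  locally_trivial x := by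
    obtain ⟨U, hU, e, he⟩ := L.exists_frame x
    obtain ⟨V, hV, f, hf⟩ := L'.exists_frame x
    exact ⟨U ⊓ V, ⟨hU, hV⟩, ⟨((he.res inf_le_left).pmul (hf.res inf_le_right)).unit.isoOn⟩⟩

section tmul

variable {L L' : LineBundle X}

/-- The section `s ⊗ t` of the tensor product. -/
def tmul {U : Opens X.carrier} (s : L.Sec U) (t : L'.Sec U) : (L.tensor L').Sec U :=
  OSet.unit _ (pmul s t)

lemma tmul_res {U V : Opens X.carrier} (h : V ≤ U) (s : L.Sec U) (t : L'.Sec U) :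
    (L.tensor L').res h (tmul s t) = tmul (L.res h s) (L'.res h t) :=
  (OSet.unit_res _ h (pmul s t)).symm

lemma smul_tmul {U : Opens X.carrier} (a b : X.Sec U) (s : L.Sec U) (t : L'.Sec U) :
    tmul (a • s) (b • t) = (a * b) • tmul s t := by
  refine (congrArg (OSet.unit _) ?_).trans (OSet.unit_smul _ (a * b) (pmul s t))
  rw [← smul_pmul, pmul_smul, mul_smul]

lemma _root_.MonoidGeometry.OSet.IsFrame.tmul {U : Opens X.carrier} {e : L.Sec U} {f : L'.Sec U}
    (he : IsFrame e) (hf : IsFrame f) : IsFrame (tmul e f) := (he.pmul hf).unit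

lemma exists_frames (L L' : LineBundle X) (x : X.carrier) :
    ∃ U : Opens X.carrier, x ∈ U ∧ ∃ (e : L.Sec U) (f : L'.Sec U), IsFrame e ∧ IsFrame f := by
  obtain ⟨U, hU, e, he⟩ := L.exists_frame x
  obtain ⟨V, hV, f, hf⟩ := L'.exists_frame x
  exact ⟨U ⊓ V, ⟨hU, hV⟩, _, _, he.res inf_le_left, hf.res inf_le_right⟩

/-- Coordinates of `e ⊗ f` in terms of coordinates of `e` and `f`. -/
lemma tmul_coord {U V W : Opens X.carrier} (hU : W ≤ U) (hV : W ≤ V) {e : L.Sec U} {f : L'.Sec U}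
    {e' : L.Sec V} {f' : L'.Sec V} {b c : X.Sec W} (hb : L.res hU e = b • L.res hV e')
    (hc : L'.res hU f = c • L'.res hV f') :
    (L.tensor L').res hU (tmul e f) = (b * c) • (L.tensor L').res hV (tmul e' f') := by
  rw [tmul_res, tmul_res, hb, hc, smul_tmul]

end tmul

lemma tensor_comm (L L' : LineBundle X) : Iso (L.tensor L') (L'.tensor L) := by
  refine FrameMatch.iso (R := fun U p q => ∃ (e : L.Sec U) (f : L'.Sec U), IsFrame e ∧ IsFrame f ∧
    p = tmul e f ∧ q = tmul f e) ⟨?_, ?_, ?_⟩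
  · rintro U _ _ ⟨e, f, he, hf, rfl, rfl⟩
    exact ⟨he.tmul hf, hf.tmul he⟩
  · intro x
    obtain ⟨U, hU, e, f, he, hf⟩ := exists_frames L L' x
    exact ⟨U, hU, _, _, e, f, he, hf, rfl, rfl⟩
  · rintro U _ _ V _ _ ⟨e, f, he, hf, rfl, rfl⟩ ⟨e', f', he', hf', rfl, rfl⟩ W hU hV a ha
    obtain ⟨b, hb⟩ := he'.exists_smul hV (L.res hU e)
    obtain ⟨c, hc⟩ := hf'.exists_smul hV (L'.res hU f)
    rw [tmul_coord hU hV hb hc] at ha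
    rw [tmul_coord hU hV hc hb, mul_comm, (he'.tmul hf').smul_cancel hV ha]

lemma tensor_assoc (L M N : LineBundle X) :
    Iso ((L.tensor M).tensor N) (L.tensor (M.tensor N)) := by
  refine FrameMatch.iso (R := fun U p q => ∃ (e : L.Sec U) (f : M.Sec U) (g : N.Sec U), IsFrame e ∧
    IsFrame f ∧ IsFrame g ∧ p = tmul (tmul e f) g ∧ q = tmul e (tmul f g)) ⟨?_, ?_, ?_⟩
  · rintro U _ _ ⟨e, f, g, he, hf, hg, rfl, rfl⟩
    exact ⟨(he.tmul hf).tmul hg, he.tmul (hf.tmul hg)⟩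
  · intro x
    obtain ⟨U, hU, e, f, he, hf⟩ := exists_frames L M x
    obtain ⟨V, hV, g, hg⟩ := N.exists_frame x
    exact ⟨U ⊓ V, ⟨hU, hV⟩, _, _, _, _, _, he.res inf_le_left, hf.res inf_le_left,
      hg.res inf_le_right, rfl, rfl⟩
  · rintro U _ _ V _ _ ⟨e, f, g, he, hf, hg, rfl, rfl⟩ ⟨e', f', g', he', hf', hg', rfl, rfl⟩
      W hU hV a ha
    obtain ⟨b, hb⟩ := he'.exists_smul hV (L.res hU e)
    obtain ⟨c, hc⟩ := hf'.exists_smul hV (M.res hU f)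
    obtain ⟨d, hd⟩ := hg'.exists_smul hV (N.res hU g)
    rw [tmul_coord hU hV (tmul_coord hU hV hb hc) hd] at ha
    rw [tmul_coord hU hV hb (tmul_coord hU hV hc hd), ← mul_assoc,
      ((he'.tmul hf').tmul hg').smul_cancel hV ha]

lemma trivial_tensor (L : LineBundle X) : Iso ((trivial X).tensor L) L := by
  refine FrameMatch.iso (R := fun U p e => IsFrame e ∧
    p = tmul (L := trivial X) (1 : X.Sec U) e) ⟨?_, ?_, ?_⟩
  · rintro U _ e ⟨he, rfl⟩
    exact ⟨(isFrame_one X U).tmul (L := trivial X) he, he⟩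
  · intro x
    obtain ⟨U, hU, e, he⟩ := L.exists_frame x
    exact ⟨U, hU, _, e, he, rfl⟩
  · rintro U _ e V _ e' ⟨he, rfl⟩ ⟨he', rfl⟩ W hU hV a ha
    obtain ⟨b, hb⟩ := he'.exists_smul hV (L.res hU e)
    have h1 : (trivial X).res hU (1 : X.Sec U) = (1 : X.Sec W) • (trivial X).res hV (1 : X.Sec V) := by
      rw [one_smul]
      exact (map_one (X.res hU)).trans (map_one (X.res hV)).symm
    rw [tmul_coord (L := trivial X) hU hV h1 hb, one_mul] at ha
    rw [hb, ((isFrame_one X V).tmul (L := trivial X) he').smul_cancel hV ha]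

lemma tensor_congr_left {L L' : LineBundle X} (h : Iso L L') (M : LineBundle X) :
    Iso (L.tensor M) (L'.tensor M) := by
  obtain ⟨i⟩ := h
  have hi : ∀ {U : Opens X.carrier} {e : L.Sec U}, IsFrame e → IsFrame (i.equiv U le_top e) := by
    intro U e he V hV
    suffices key : (fun a : X.Sec V => a • L'.res hV (i.equiv U le_top e)) =
        i.equiv V le_top ∘ fun a : X.Sec V => a • L.res hV e by
      rw [key]
      exact (i.equiv V le_top).bijective.comp (he V hV)
    funext a
    rw [Function.comp_apply, i.map_smul, i.map_res U V le_top hV]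
  refine FrameMatch.iso (R := fun U p q => ∃ (e : L.Sec U) (f : M.Sec U), IsFrame e ∧ IsFrame f ∧
    p = tmul e f ∧ q = tmul (i.equiv U le_top e) f) ⟨?_, ?_, ?_⟩
  · rintro U _ _ ⟨e, f, he, hf, rfl, rfl⟩
    exact ⟨he.tmul hf, (hi he).tmul hf⟩
  · intro x
    obtain ⟨U, hU, e, f, he, hf⟩ := exists_frames L M x
    exact ⟨U, hU, _, _, e, f, he, hf, rfl, rfl⟩
  · rintro U _ _ V _ _ ⟨e, f, he, hf, rfl, rfl⟩ ⟨e', f', he', hf', rfl, rfl⟩ W hU hV a ha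
    obtain ⟨b, hb⟩ := he'.exists_smul hV (L.res hU e)
    obtain ⟨c, hc⟩ := hf'.exists_smul hV (M.res hU f)
    have hb' : L'.res hU (i.equiv U le_top e) = b • L'.res hV (i.equiv V le_top e') := by
      rw [← i.map_res U W le_top hU, ← i.map_res V W le_top hV, hb, i.map_smul]
    rw [tmul_coord hU hV hb hc] at ha
    rw [tmul_coord hU hV hb' hc, (he'.tmul hf').smul_cancel hV ha]

/-! ### Duals -/

/-- An `O_X`-linear map `L|_U → O_X|_U`. -/
@[ext]
structure DualSec (L : LineBundle X) (U : Opens X.carrier) : Type u where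
  toFun : ∀ V : Opens X.carrier, V ≤ U → L.Sec V → X.Sec V
  map_smul : ∀ V hV (a : X.Sec V) (s : L.Sec V), toFun V hV (a • s) = a * toFun V hV s
  map_res : ∀ V W (hV : V ≤ U) (hW : W ≤ V) (s : L.Sec V),
    toFun W (hW.trans hV) (L.res hW s) = X.res hW (toFun V hV s)

instance (L : LineBundle X) (U : Opens X.carrier) : MulAction (X.Sec U) (L.DualSec U) where
  smul a φ := ⟨fun V hV s => X.res hV a * φ.toFun V hV s,
    fun V hV b s => by rw [φ.map_smul, mul_left_comm],
    fun V W hV hW s => by rw [φ.map_res V W hV hW, map_mul, MonoidScheme.res_res]⟩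
  one_smul φ := DualSec.ext (funext fun V => funext fun hV => funext fun s => by
    change X.res hV 1 * φ.toFun V hV s = _
    rw [map_one, one_mul])
  mul_smul a b φ := DualSec.ext (funext fun V => funext fun hV => funext fun s => by
    change X.res hV (a * b) * φ.toFun V hV s = X.res hV a * (X.res hV b * φ.toFun V hV s)
    rw [map_mul, mul_assoc])

lemma DualSec.smul_toFun {L : LineBundle X} {U : Opens X.carrier} (a : X.Sec U) (φ : L.DualSec U)
    (V : Opens X.carrier) (hV : V ≤ U) (s : L.Sec V) :
    (a • φ).toFun V hV s = X.res hV a * φ.toFun V hV s := rfl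

/-- The sheaf of linear maps `L → O_X`. -/
def dualSet (L : LineBundle X) : OSet X where
  presheaf :=
    { obj := fun U => L.DualSec U.unop
      map := fun {U V} i => ↾(fun φ => ⟨fun W hW s => φ.toFun W (hW.trans i.unop.le) s,
        fun W hW a s => φ.map_smul W _ a s, fun W T hW hT s => φ.map_res W T _ hT s⟩) }
  act U := (inferInstance : MulAction (X.Sec U) (L.DualSec U))
  map_smul {U V} h a φ := DualSec.ext (funext fun W => funext fun hW => funext fun s => by
    change X.res (hW.trans h) a * _ = X.res hW (X.res h a) * _
    rw [MonoidScheme.res_res]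
    rfl)

lemma dualSet_isSheaf (L : LineBundle X) : L.dualSet.presheaf.IsSheaf := by
  refine TopCat.Presheaf.isSheaf_of_isSheafUniqueGluing_types _ fun {ι} U φ hφ => ?_
  have hφ' : ∀ (i j : ι) (W : Opens X.carrier) (hi : W ≤ U i) (hj : W ≤ U j) (s : L.Sec W),
      (show L.DualSec (U i) from φ i).toFun W hi s =
        (show L.DualSec (U j) from φ j).toFun W hj s := fun i j W hi hj s =>
    congrFun (congrFun (congrFun (congrArg (DualSec.toFun (U := U i ⊓ U j)) (hφ i j)) W)
      (le_inf hi hj)) s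
  let ψ : ∀ i, L.DualSec (U i) := φ
  have cov : ∀ V : Opens X.carrier, V ≤ iSup U → ∀ x ∈ V, ∃ i, x ∈ U i := fun V hV x hx =>
    Opens.mem_iSup.1 (hV hx)
  have ex : ∀ (V : Opens X.carrier) (_ : V ≤ iSup U) (s : L.Sec V), ∃ a : X.Sec V,
      ∀ (i : ι) (W : Opens X.carrier) (hi : W ≤ U i) (hW : W ≤ V),
        X.res hW a = (ψ i).toFun W hi (L.res hW s) := by
    intro V hV s
    obtain ⟨a, ha⟩ := sec_glue (U := V) (fun W t => ∃ (i : ι) (hi : W ≤ U i) (hW : W ≤ V),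
      t = (ψ i).toFun W hi (L.res hW s)) (by
        intro x hx
        obtain ⟨i, hi⟩ := cov V hV x hx
        exact ⟨U i ⊓ V, inf_le_right, ⟨hi, hx⟩, _, i, inf_le_left, inf_le_right, rfl⟩) (by
        rintro W W' _ _ ⟨i, hi, hW, rfl⟩ ⟨j, hj, hW', rfl⟩ T hT hT'
        rw [← (ψ i).map_res W T hi hT, ← (ψ j).map_res W' T hj hT', res_res, res_res]
        exact hφ' i j T _ _ _)
    exact ⟨a, fun i W hi hW => ha W hW _ ⟨i, hi, hW, rfl⟩⟩
  choose F hF using ex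
  have uniq : ∀ (V : Opens X.carrier) (hV : V ≤ iSup U) (a b : X.Sec V),
      (∀ (i : ι) (W : Opens X.carrier) (_ : W ≤ U i) (hW : W ≤ V), X.res hW a = X.res hW b) →
        a = b := by
    intro V hV a b h
    refine sec_ext fun x hx => ?_
    obtain ⟨i, hi⟩ := cov V hV x hx
    exact ⟨U i ⊓ V, inf_le_right, ⟨hi, hx⟩, h i _ inf_le_left inf_le_right⟩
  let Φ : L.DualSec (iSup U) :=
    ⟨F, fun V hV a s => uniq V hV _ _ fun i W hi hW => by
      rw [hF V hV (a • s) i W hi hW, map_mul, hF V hV s i W hi hW, res_smul, (ψ i).map_smul],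
    fun V W hV hW s => uniq W (hW.trans hV) _ _ fun i T hi hT => by
      rw [hF W _ _ i T hi hT, MonoidScheme.res_res, hF V hV s i T hi (hT.trans hW), res_res]⟩
  refine ⟨Φ, fun i => ?_, fun Ψ hΨ => ?_⟩
  · refine DualSec.ext (funext fun V => funext fun hV => funext fun s => ?_)
    have := hF V (hV.trans (le_iSup U i)) s i V hV le_rfl
    rw [MonoidScheme.res_refl, res_refl] at this
    exact this
  · refine DualSec.ext (funext fun V => funext fun hV => funext fun s => ?_)
    refine uniq V hV _ _ fun i W hi hW => ?_
    have h1 := congrFun (congrFun (congrFun (congrArg (DualSec.toFun (U := U i)) (hΨ i)) W) hi)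
      (L.res hW s)
    refine Eq.trans ?_ (hF V hV s i W hi hW).symm
    exact ((DualSec.map_res (show L.DualSec (iSup U) from Ψ) V W hV hW s).symm).trans h1

/-- The coordinate with respect to a frame. -/
def coord {L : LineBundle X} {U : Opens X.carrier} {e : L.Sec U} (he : IsFrame e) : L.DualSec U where
  toFun V hV s := (he.exists_smul hV s).choose
  map_smul V hV a s := he.smul_cancel hV (by
    rw [← (he.exists_smul hV (a • s)).choose_spec, mul_smul, ← (he.exists_smul hV s).choose_spec])
  map_res V W hV hW s := he.smul_cancel (hW.trans hV) (by
    rw [← (he.exists_smul (hW.trans hV) (L.res hW s)).choose_spec, ← res_res hV hW, ← res_smul,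
      ← (he.exists_smul hV s).choose_spec])

lemma coord_spec {L : LineBundle X} {U : Opens X.carrier} {e : L.Sec U} (he : IsFrame e)
    {V : Opens X.carrier} (hV : V ≤ U) (s : L.Sec V) :
    s = (coord he).toFun V hV s • L.res hV e := (he.exists_smul hV s).choose_spec

lemma coord_self {L : LineBundle X} {U : Opens X.carrier} {e : L.Sec U} (he : IsFrame e)
    {V : Opens X.carrier} (hV : V ≤ U) : (coord he).toFun V hV (L.res hV e) = 1 :=
  he.smul_cancel hV (by rw [← coord_spec, one_smul])

lemma isFrame_coord {L : LineBundle X} {U : Opens X.carrier} {e : L.Sec U} (he : IsFrame e) :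
    IsFrame (L := L.dualSet) (show L.dualSet.Sec U from coord he) := by
  intro V hV
  constructor
  · intro a b hab
    have h := congrFun (congrFun (congrFun (congrArg (DualSec.toFun (U := V)) hab) V) le_rfl)
      (L.res hV e)
    have h' : X.res le_rfl a * (coord he).toFun V hV (L.res hV e) =
      X.res le_rfl b * (coord he).toFun V hV (L.res hV e) := h
    rwa [coord_self, mul_one, mul_one, MonoidScheme.res_refl, MonoidScheme.res_refl] at h'
  · intro φ
    let ψ : L.DualSec V := φ
    refine ⟨ψ.toFun V le_rfl (L.res hV e), DualSec.ext (funext fun W => funext fun hW =>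
      funext fun s => ?_)⟩
    change X.res hW (ψ.toFun V le_rfl (L.res hV e)) * (coord he).toFun W (hW.trans hV) s =
      ψ.toFun W hW s
    conv_rhs => rw [coord_spec he (hW.trans hV) s]
    rw [ψ.map_smul, mul_comm, ← ψ.map_res V W le_rfl hW, res_res]

/-- The dual line bundle. -/
def dual (L : LineBundle X) : LineBundle X where
  toOSet := L.dualSet
  isSheaf := L.dualSet_isSheaf
  locally_trivial x := by
    obtain ⟨U, hU, e, he⟩ := L.exists_frame x
    exact ⟨U, hU, ⟨(isFrame_coord he).isoOn⟩⟩

lemma dual_tensor (L : LineBundle X) : Iso (L.dual.tensor L) (trivial X) := by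
  refine FrameMatch.iso (R := fun U p q => ∃ (e : L.Sec U) (he : IsFrame e),
    p = tmul (L := L.dual) (show L.dual.Sec U from coord he) e ∧ q = (1 : X.Sec U)) ⟨?_, ?_, ?_⟩
  · rintro U _ _ ⟨e, he, rfl, rfl⟩
    exact ⟨(isFrame_coord he).tmul (L := L.dual) he, isFrame_one X U⟩
  · intro x
    obtain ⟨U, hU, e, he⟩ := L.exists_frame x
    exact ⟨U, hU, _, _, e, he, rfl, rfl⟩
  · rintro U _ _ V _ _ ⟨e, he, rfl, rfl⟩ ⟨e', he', rfl, rfl⟩ W hU hV a ha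
    obtain ⟨b, hb⟩ := he'.exists_smul hV (L.res hU e)
    obtain ⟨c, hc⟩ := (isFrame_coord he').exists_smul hV
      (L.dual.res hU (show L.dual.Sec U from coord he))
    have h1 : c * b = 1 := by
      have h2 := congrFun (congrFun (congrFun (congrArg (DualSec.toFun (U := W)) hc) W) le_rfl)
        (L.res hU e)
      have h3 : (coord he).toFun W hU (L.res hU e) =
        X.res le_rfl c * (coord he').toFun W hV (L.res hU e) := h2
      rw [coord_self, MonoidScheme.res_refl, hb, (coord he').map_smul, coord_self, mul_one] at h3
      exact h3.symm
    rw [tmul_coord (L := L.dual) hU hV hc hb, h1] at ha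
    have h4 : (1 : X.Sec W) = a :=
      ((isFrame_coord he').tmul (L := L.dual) he').smul_cancel hV ha
    subst h4
    rw [one_smul]
    exact (map_one (X.res hU)).trans (map_one (X.res hV)).symm

end LineBundle

/-! ### The Picard group -/

/-- The set of isomorphism classes of line bundles on `X`. -/
def Pic (X : MonoidScheme.{u}) : Type (u + 1) := Quotient (LineBundle.isoSetoid X)

namespace Pic

variable {X : MonoidScheme.{u}}

/-- The isomorphism class of a line bundle. -/
def mk (L : LineBundle X) : Pic X := Quotient.mk _ L

/-- `Pic(X)` is an abelian group under the tensor product. -/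
instance : CommGroup (Pic X) where
  mul := Quotient.map₂ LineBundle.tensor fun _ L' h M _ h' =>
    (LineBundle.tensor_congr_left h M).trans (((LineBundle.tensor_comm L' M).trans
      (LineBundle.tensor_congr_left h' L')).trans (LineBundle.tensor_comm _ L'))
  mul_assoc := by
    rintro ⟨L⟩ ⟨M⟩ ⟨N⟩
    exact Quotient.sound (LineBundle.tensor_assoc L M N)
  one := mk (LineBundle.trivial X)
  one_mul := by
    rintro ⟨L⟩
    exact Quotient.sound (LineBundle.trivial_tensor L)
  mul_one := by
    rintro ⟨L⟩
    exact Quotient.sound ((LineBundle.tensor_comm L _).trans (LineBundle.trivial_tensor L))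
  inv p := mk (Quotient.out p).dual
  inv_mul_cancel := by
    intro p
    induction p using Quotient.inductionOn with
    | _ L =>
      refine Eq.trans ?_ (Quotient.sound (LineBundle.dual_tensor (Quotient.out (mk L))))
      exact congrArg (Quotient.map₂ LineBundle.tensor _ (mk (Quotient.out (mk L)).dual))
        (Quotient.out_eq (mk L)).symm
  mul_comm := by
    rintro ⟨L⟩ ⟨M⟩
    exact Quotient.sound (LineBundle.tensor_comm L M)

end Pic

/-! ### The line bundle of an `s`-divisor -/

/-- The line bundle `L` arises from the `s`-divisor `D`: there are frames `τ f` of `L|_U`, one for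
each section `f` of `sM_X^*` over an open set `U` that represents `D` there, with
`τ (g f) = g τ f` for units `g` of `O_X(U)` and compatible with restriction. In other words, the
sheaf of frames of `L` is the `O_X^*`-torsor of local representatives of `D`; its class is the
image of `D` under the connecting homomorphism of
`1 → O_X^* → sM_X^* → sM_X^* / O_X^* → 1`. -/
def MonoidScheme.IsAssociated (X : MonoidScheme.{u}) (D : X.SDivisor) (L : LineBundle X) : Prop :=
  ∃ τ : ∀ (U : Opens X.carrier) (f : X.SMerUnits U), X.Represents D.1 f → L.Sec U,
    (∀ U f hf, OSet.IsFrame (τ U f hf)) ∧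
    (∀ (U : Opens X.carrier) (g : (X.Sec U)ˣ) (f : X.SMerUnits U) (hf : X.Represents D.1 f)
      (hgf : X.Represents D.1 (X.unitsToSMer U g * f)),
      τ U (X.unitsToSMer U g * f) hgf = (g : X.Sec U) • τ U f hf) ∧
    (∀ (U V : Opens X.carrier) (h : V ≤ U) (f : X.SMerUnits U) (hf : X.Represents D.1 f),
      τ V (X.sMerRes h f) (hf.res X h) = L.res h (τ U f hf))

/-- The restriction of `sM_X^*` to the open set `W` is a constant sheaf: for some abelian group `G`,
its sections over `U ⊆ W` are the locally constant functions `U → G`, compatibly with products and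
restrictions. -/
def MonoidScheme.SMerUnitsConstantOn (X : MonoidScheme.{u}) (W : Opens X.carrier) : Prop :=
  ∃ (G : Type u) (_ : CommGroup G)
    (e : ∀ U : Opens X.carrier, U ≤ W → (X.SMerUnits U ≃* LocallyConstant U G)),
    ∀ (U V : Opens X.carrier) (hU : U ≤ W) (h : V ≤ U) (f : X.SMerUnits U) (x : V),
      e V (h.trans hU) (X.sMerRes h f) x = e U hU f ⟨x.1, h x.2⟩

end MonoidGeometry

end

noncomputable section

namespace MonoidGeometry

section

/-! ### Units and the localisation at the `s`-regular elements -/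

/-! The sequence `1 → O_X^* → sM_X^* → sM_X^* / O_X^* → 1` is exact: the definition of
`s`-regularity is just strong enough to keep two distinct units of a stalk distinct after inverting
the `s`-regular elements (`unitsToSMer_injective`). Hence the local representatives of an
`s`-divisor `D` form an `O_X^*`-torsor (`Represents.exists_unit`). The line bundle of `D` consists
of the functions `s` on representatives with `s(gf) g = s(f)`; such an `s` stands for the section
`s(f) τ(f)`, where `τ(gf) = g τ(f)`.

Everything about the homomorphism is a comparison of coordinate changes. A `FrameRep` matches some
sections of `sM_X^*` with some frames of `L` so that both change by the same units; it determines an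
`s`-divisor (`FrameRep.exists_sDivisor`) and shows that `L` is associated to it
(`FrameRep.isAssociated`). Uniqueness of `L`, multiplicativity in `D`, and the fact that the kernel
consists of the principal divisors are all obtained by writing down a suitable matching.

For surjectivity let `X` be `s`-cancellative. Every point has a neighbourhood with a generic point,
whose stalk is a group (the empty prime ideal of a chart). If `a^m u = a^m v` in a stalk, then `u =
v` at the generic point, hence, by `s`-cancellativity, already at the generalisation where `uv` is
inverted, and this says `(uv)^n u = (uv)^n v`. So all elements of all stalks are `s`-regular
(`IsSCancellative.isSRegular`), each `sM_{X,p} → sM_{X,q}` is the identity of one group up to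
isomorphism (`IsSCancellative.sMerMap_bijective`), and a section of `sM_X^*` amounts to one
arbitrary unit at each generic point. This gives constancy on connected open sets. It also realises
any `L`: fix a frame near each generic point and match a frame of `L` with the section recording its
coordinates with respect to the fixed ones. -/

lemma units_eq_of_monoidOf_eq {A : Type u} [CommMonoid A] {a b : A} (ha : IsUnit a) (hb : IsUnit b)
    (h : Localization.monoidOf (sRegular A) a = Localization.monoidOf (sRegular A) b) : a = b := by
  obtain ⟨c, hc⟩ := (Localization.monoidOf (sRegular A)).eq_iff_exists.1 h
  -- Exponent `m = 1` suffices; in the resulting equality `(ab)^n a = (ab)^n b` the factor `ab` is a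
  -- unit.
  obtain ⟨n, hn⟩ := c.2 1 a b (by rw [pow_one]; exact hc)
  exact ((ha.mul hb).pow n).mul_left_cancel hn

namespace MonoidScheme

variable {X : MonoidScheme.{u}}

/-! ### Sections of `sM_X^*` as families -/

/-- The value at `x` of a section of `sM_X^*`. -/
def smVal {U : Opens X.carrier} (x : X.carrier) (hx : x ∈ U) : X.SMerUnits U →* X.SMerAt x where
  toFun f := (show {s // X.isCompatible.pred (U := U) s} from f.1).1 ⟨x, hx⟩
  map_one' := rfl
  map_mul' _ _ := rfl

lemma smVal_ext {U : Opens X.carrier} {f g : X.SMerUnits U}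
    (h : ∀ x hx, smVal x hx f = smVal x hx g) : f = g :=
  Units.ext (Subtype.ext (funext fun x => h x.1 x.2))

lemma smVal_res {U V : Opens X.carrier} (h : V ≤ U) (x : X.carrier) (hx : x ∈ V)
    (f : X.SMerUnits U) : smVal x hx (X.sMerRes h f) = smVal x (h hx) f := rfl

lemma smVal_units {U : Opens X.carrier} (x : X.carrier) (hx : x ∈ U) (g : (X.Sec U)ˣ) :
    smVal x hx (X.unitsToSMer U g) =
      Localization.monoidOf _ (X.presheaf.germ U x hx (g : X.Sec U)) := rfl

lemma smVal_map {U : Opens X.carrier} {q p : X.carrier} (h : q ⤳ p) (hq : q ∈ U) (hp : p ∈ U)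
    (f : X.SMerUnits U) : X.sMerMap h (smVal p hp f) = smVal q hq f :=
  (show {s // X.isCompatible.pred (U := U) s} from f.1).2 ⟨q, hq⟩ ⟨p, hp⟩ h

/-- The section of `sM_X^*` with given values. -/
def smMk (U : Opens X.carrier) (v : ∀ x ∈ U, (X.SMerAt x)ˣ)
    (hv : ∀ q p (h : q ⤳ p) (hq : q ∈ U) (hp : p ∈ U), Units.map (X.sMerMap h) (v p hp) = v q hq) :
    X.SMerUnits U where
  val := ⟨fun x => (v x.1 x.2 : X.SMerAt x.1), fun q p h =>
    congrArg Units.val (hv q.1 p.1 h q.2 p.2)⟩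
  inv := ⟨fun x => ((v x.1 x.2)⁻¹ : (X.SMerAt x.1)ˣ).1, fun q p h => by
    have := congrArg Units.val (congrArg (·⁻¹) (hv q.1 p.1 h q.2 p.2))
    exact this⟩
  val_inv := Subtype.ext (funext fun x => (v x.1 x.2).mul_inv)
  inv_val := Subtype.ext (funext fun x => (v x.1 x.2).inv_mul)

lemma smVal_smMk (U : Opens X.carrier) (v : ∀ x ∈ U, (X.SMerAt x)ˣ) (hv) (x : X.carrier)
    (hx : x ∈ U) : smVal x hx (smMk U v hv) = v x hx := rfl

lemma sMerRes_res {U V W : Opens X.carrier} (h : V ≤ U) (h' : W ≤ V) (f : X.SMerUnits U) :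
    X.sMerRes h' (X.sMerRes h f) = X.sMerRes (h'.trans h) f := rfl

lemma sMerRes_units {U V : Opens X.carrier} (h : V ≤ U) (g : (X.Sec U)ˣ) :
    X.sMerRes h (X.unitsToSMer U g) = X.unitsToSMer V (Units.map (X.res h) g) :=
  smVal_ext fun x hx => by
    rw [smVal_res, smVal_units, smVal_units]
    exact congrArg _ (TopCat.Presheaf.germ_res_apply X.presheaf (homOfLE h) x hx _).symm

lemma sMer_ext_local {U : Opens X.carrier} {f g : X.SMerUnits U}
    (h : ∀ x ∈ U, ∃ (V : Opens X.carrier) (hV : V ≤ U), x ∈ V ∧ X.sMerRes hV f = X.sMerRes hV g) :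
    f = g := smVal_ext fun x hx => by
  obtain ⟨V, hV, hxV, e⟩ := h x hx
  exact congrArg (smVal x hxV) e

/-- Sections of `sM_X^*` can be glued. -/
lemma sMer_glue {U : Opens X.carrier} (P : ∀ V : Opens X.carrier, X.SMerUnits V → Prop)
    (ex : ∀ x ∈ U, ∃ V : Opens X.carrier, V ≤ U ∧ x ∈ V ∧ ∃ t : X.SMerUnits V, P V t)
    (compat : ∀ (V V' : Opens X.carrier) (t : X.SMerUnits V) (t' : X.SMerUnits V'), P V t →
      P V' t' → ∀ (W : Opens X.carrier) (h : W ≤ V) (h' : W ≤ V'),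
        X.sMerRes h t = X.sMerRes h' t') :
    ∃ s : X.SMerUnits U, ∀ (V : Opens X.carrier) (h : V ≤ U) (t : X.SMerUnits V), P V t →
      X.sMerRes h s = t := by
  have compat' : ∀ (V V' : Opens X.carrier) (t : X.SMerUnits V) (t' : X.SMerUnits V'), P V t →
      P V' t' → ∀ x (h : x ∈ V) (h' : x ∈ V'), smVal x h t = smVal x h' t' := by
    intro V V' t t' ht ht' x h h'
    exact congrArg (smVal x (U := V ⊓ V') ⟨h, h'⟩)
      (compat V V' t t' ht ht' (V ⊓ V') inf_le_left inf_le_right)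
  choose V hV hx t ht using ex
  -- `smVal` takes values in a monoid; being a homomorphism from a group it lands in the units,
  -- which `toUnits` makes explicit.
  refine ⟨smMk U (fun x hxU => Units.map (smVal x (hx x hxU)) (toUnits (t x hxU))) ?_, ?_⟩
  · intro q p h hq hp
    refine Units.ext ?_
    change X.sMerMap h (smVal p (hx p hp) (t p hp)) = smVal q (hx q hq) (t q hq)
    rw [smVal_map h (h.mem_open (V p hp).isOpen (hx p hp))]
    exact compat' _ _ _ _ (ht p hp) (ht q hq) _ _ _
  · intro W hW s hs
    exact smVal_ext fun x hxW => compat' _ _ _ _ (ht x (hW hxW)) hs x _ hxW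

/-! ### Units of the structure sheaf -/

lemma sec_ext_germ {U : Opens X.carrier} {a b : X.Sec U}
    (h : ∀ x hx, X.presheaf.germ U x hx a = X.presheaf.germ U x hx b) : a = b := by
  refine OSet.sec_ext fun x hx => ?_
  obtain ⟨W, hW, i, j, e⟩ := TopCat.Presheaf.germ_eq X.presheaf x hx hx a b (h x hx)
  exact ⟨W, i.le, hW, e⟩

/-- Exactness on the left. It is the source of every uniqueness statement below: a unit of `O_X` is
known once the quotient of two sections of `sM_X^*` is known. -/
lemma unitsToSMer_injective (U : Opens X.carrier) : Function.Injective (X.unitsToSMer U) := by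
  intro g h e
  refine Units.ext (sec_ext_germ fun x hx => units_eq_of_monoidOf_eq ?_ ?_ ?_)
  · exact g.isUnit.map (X.presheaf.germ U x hx).hom
  · exact h.isUnit.map (X.presheaf.germ U x hx).hom
  · exact congrArg (smVal x hx) e

/-- Inverses are unique, so local inverses agree on overlaps and glue. -/
lemma isUnit_of_locally {U : Opens X.carrier} {a : X.Sec U}
    (h : ∀ x ∈ U, ∃ (V : Opens X.carrier) (hV : V ≤ U), x ∈ V ∧ IsUnit (X.res hV a)) :
    IsUnit a := by
  have ex : ∀ x ∈ U, ∃ V : Opens X.carrier, V ≤ U ∧ x ∈ V ∧ ∃ t : X.Sec V,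
      ∃ hV : V ≤ U, X.res hV a * t = 1 := by
    intro x hx
    obtain ⟨V, hV, hxV, ha⟩ := h x hx
    obtain ⟨t, ht⟩ := ha.exists_right_inv
    exact ⟨V, hV, hxV, t, hV, ht⟩
  obtain ⟨b, hb⟩ := OSet.sec_glue (U := U) (fun V t => ∃ hV : V ≤ U, X.res hV a * t = 1) ex (by
    rintro V V' t t' ⟨hV, ht⟩ ⟨hV', ht'⟩ W hW hW'
    have e1 := congrArg (X.res hW) ht
    have e2 := congrArg (X.res hW') ht'
    rw [map_mul, map_one, res_res] at e1 e2
    exact (IsUnit.of_mul_eq_one _ e1).mul_left_cancel (e1.trans e2.symm))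
  refine IsUnit.of_mul_eq_one b (OSet.sec_ext fun x hx => ?_)
  obtain ⟨V, hV, hxV, t, ht⟩ := ex x hx
  refine ⟨V, hV, hxV, ?_⟩
  rw [map_mul, map_one, hb V hV t ht]
  exact ht.2

/-- A unit of the stalk extends to a unit near the point. -/
lemma exists_unit_germ (x : X.carrier) (w : (X.Stalk x)ˣ) :
    ∃ (V : Opens X.carrier) (hx : x ∈ V) (g : (X.Sec V)ˣ),
      X.presheaf.germ V x hx (g : X.Sec V) = w := by
  obtain ⟨V, hV, a, ha⟩ := TopCat.Presheaf.exists_germ_eq X.presheaf (w : X.Stalk x)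
  obtain ⟨V', hV', b, hb⟩ := TopCat.Presheaf.exists_germ_eq X.presheaf ((w⁻¹ : (X.Stalk x)ˣ) : X.Stalk x)
  let i : V ⊓ V' ⟶ V := Opens.infLELeft V V'
  let j : V ⊓ V' ⟶ V' := Opens.infLERight V V'
  have hx : x ∈ V ⊓ V' := ⟨hV, hV'⟩
  have h1 : X.presheaf.germ (V ⊓ V') x hx (X.res i.le a * X.res j.le b) =
      X.presheaf.germ (V ⊓ V') x hx 1 := by
    rw [map_mul, map_one]
    refine (congrArg₂ (· * ·) (TopCat.Presheaf.germ_res_apply X.presheaf i x hx a)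
      (TopCat.Presheaf.germ_res_apply X.presheaf j x hx b)).trans ?_
    rw [ha, hb]
    exact w.mul_inv
  -- Lifts of `w` and `w⁻¹` multiply to `1` only at `x`, hence on a smaller neighbourhood.
  obtain ⟨W, hW, k, l, e⟩ := TopCat.Presheaf.germ_eq X.presheaf x hx hx _ _ h1
  have e' : X.res k.le (X.res i.le a * X.res j.le b) = X.res l.le 1 := e
  rw [map_mul, map_one] at e'
  refine ⟨W, hW, Units.mkOfMulEqOne _ _ e', ?_⟩
  refine (TopCat.Presheaf.germ_res_apply X.presheaf k x hW _).trans ?_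
  exact (TopCat.Presheaf.germ_res_apply X.presheaf i x hx a).trans ha

/-! ### Representatives of an `s`-divisor up to units -/

lemma stalkUnitsToSMer_germ {V : Opens X.carrier} (x : X.carrier) (hx : x ∈ V) (g : (X.Sec V)ˣ) :
    X.stalkUnitsToSMer x (Units.map (X.presheaf.germ V x hx).hom g) =
      Units.map (X.sMer.presheaf.germ V x hx).hom (X.unitsToSMer V g) :=
  Units.ext (TopCat.Presheaf.stalkFunctor_map_germ_apply V x hx X.toSMer (g : X.Sec V))

lemma sDivGerm_units {V : Opens X.carrier} (x : X.carrier) (hx : x ∈ V) (g : (X.Sec V)ˣ) :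
    X.sDivGerm x hx (X.unitsToSMer V g) = 1 :=
  (QuotientGroup.eq_one_iff _).2 ⟨_, stalkUnitsToSMer_germ x hx g⟩

/-- Equality in the stalk of the quotient is equality of germs up to a unit of `O_{X,x}`; that unit
and then the equality spread out to a neighbourhood. -/
lemma sDivGerm_eq {U U' : Opens X.carrier} {x : X.carrier} (hx : x ∈ U) (hx' : x ∈ U')
    {f : X.SMerUnits U} {f' : X.SMerUnits U'} (h : X.sDivGerm x hx f = X.sDivGerm x hx' f') :
    ∃ (W : Opens X.carrier) (hU : W ≤ U) (hU' : W ≤ U') (_ : x ∈ W) (g : (X.Sec W)ˣ),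
      X.sMerRes hU f = X.unitsToSMer W g * X.sMerRes hU' f' := by
  obtain ⟨w, hw⟩ := QuotientGroup.eq.1 h.symm
  obtain ⟨V, hV, g, hg⟩ := exists_unit_germ x w
  obtain rfl : Units.map (X.presheaf.germ V x hV).hom g = w := Units.ext hg
  rw [stalkUnitsToSMer_germ, eq_inv_mul_iff_mul_eq] at hw
  have hx2 : x ∈ V ⊓ (U ⊓ U') := ⟨hV, hx, hx'⟩
  have e : X.sMer.presheaf.germ _ x hx2
      (X.sMerRes (inf_le_right.trans inf_le_right) f' * X.sMerRes inf_le_left (X.unitsToSMer V g)).1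
      = X.sMer.presheaf.germ _ x hx2 (X.sMerRes (inf_le_right.trans inf_le_left) f).1 := by
    rw [Units.val_mul, map_mul]
    refine (congrArg₂ (· * ·) (TopCat.Presheaf.germ_res_apply X.sMer.presheaf (homOfLE _) x hx2 _)
      (TopCat.Presheaf.germ_res_apply X.sMer.presheaf (homOfLE _) x hx2 _)).trans ?_
    refine Eq.trans ?_ (TopCat.Presheaf.germ_res_apply X.sMer.presheaf (homOfLE _) x hx2 _).symm
    exact congrArg Units.val hw
  obtain ⟨W, hW, i, j, e'⟩ := TopCat.Presheaf.germ_eq X.sMer.presheaf x hx2 hx2 _ _ e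
  have hVW : W ≤ V := i.le.trans inf_le_left
  refine ⟨W, i.le.trans (inf_le_right.trans inf_le_left), i.le.trans (inf_le_right.trans inf_le_right), hW,
    Units.map (X.res hVW) g, ?_⟩
  rw [← sMerRes_units, mul_comm]
  exact Units.ext e'.symm

/-- Two representatives of an `s`-divisor differ by a unit of `O_X`. -/
lemma Represents.exists_unit {D : ∀ x, X.SDivAt x} {U : Opens X.carrier} {f f' : X.SMerUnits U}
    (hf : X.Represents D f) (hf' : X.Represents D f') :
    ∃ g : (X.Sec U)ˣ, f = X.unitsToSMer U g * f' := by
  have ex : ∀ x ∈ U, ∃ V : Opens X.carrier, V ≤ U ∧ x ∈ V ∧ ∃ t : X.Sec V,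
      ∃ (hV : V ≤ U) (g : (X.Sec V)ˣ), t = g ∧
        X.sMerRes hV f = X.unitsToSMer V g * X.sMerRes hV f' := by
    intro x hx
    obtain ⟨W, hU, _, hxW, g, hg⟩ := sDivGerm_eq hx hx ((hf x hx).symm.trans (hf' x hx))
    exact ⟨W, hU, hxW, g, hU, g, rfl, hg⟩
  -- The local units are glued as sections of `O_X`; they agree on overlaps by
  -- `unitsToSMer_injective`. That the result is a unit is checked afterwards.
  obtain ⟨a, ha⟩ := OSet.sec_glue (U := U) _ ex (by
    rintro V V' _ _ ⟨hV, g, rfl, hg⟩ ⟨hV', g', rfl, hg'⟩ W hW hW'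
    have e1 := congrArg (X.sMerRes hW) hg
    have e2 := congrArg (X.sMerRes hW') hg'
    rw [map_mul, sMerRes_res, sMerRes_res, sMerRes_units] at e1 e2
    exact congrArg Units.val (unitsToSMer_injective W (mul_right_cancel (e1.symm.trans e2))))
  have hu : IsUnit a := isUnit_of_locally fun x hx => by
    obtain ⟨V, hV, hxV, t, ht⟩ := ex x hx
    refine ⟨V, hV, hxV, ?_⟩
    rw [ha V hV t ht]
    obtain ⟨_, g, rfl, _⟩ := ht
    exact g.isUnit
  obtain ⟨g, rfl⟩ := hu
  refine ⟨g, sMer_ext_local fun x hx => ?_⟩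
  obtain ⟨V, hV, hxV, t, ht⟩ := ex x hx
  have hg := ha V hV t ht
  obtain ⟨_, k, rfl, hk⟩ := ht
  refine ⟨V, hV, hxV, ?_⟩
  rw [map_mul, sMerRes_units, hk, show Units.map (X.res hV) g = k from Units.ext hg]

lemma Represents.unit_mul {D : ∀ x, X.SDivAt x} {U : Opens X.carrier} {f : X.SMerUnits U}
    (hf : X.Represents D f) (g : (X.Sec U)ˣ) : X.Represents D (X.unitsToSMer U g * f) := by
  intro x hx
  rw [map_mul, sDivGerm_units, one_mul]
  exact hf x hx

end MonoidScheme

/-! ### Frames and units -/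

namespace OSet

variable {X : MonoidScheme.{u}} {L : OSet X}

lemma IsFrame.units_smul {U : Opens X.carrier} {e : L.Sec U} (he : IsFrame e) (g : (X.Sec U)ˣ) :
    IsFrame ((g : X.Sec U) • e) := by
  intro V hV
  have key : (fun a : X.Sec V => a • L.res hV ((g : X.Sec U) • e)) =
      (fun a : X.Sec V => a • L.res hV e) ∘ fun a => a * X.res hV g := by
    funext a
    rw [Function.comp_apply, res_smul, mul_smul]
  rw [key]
  exact (he V hV).comp (Units.mulRight_bijective (Units.map (X.res hV) g))

/-- Each frame is a multiple of the other, and the product of the two coordinates fixes a frame, so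
it is `1`. -/
lemma IsFrame.exists_unit {U V W : Opens X.carrier} {e : L.Sec U} {e' : L.Sec V} (he : IsFrame e)
    (he' : IsFrame e') (hU : W ≤ U) (hV : W ≤ V) :
    ∃ g : (X.Sec W)ˣ, L.res hU e = (g : X.Sec W) • L.res hV e' := by
  obtain ⟨a, ha⟩ := he'.exists_smul hV (L.res hU e)
  obtain ⟨b, hb⟩ := he.exists_smul hU (L.res hV e')
  refine ⟨Units.mkOfMulEqOne a b (he.smul_cancel hU ?_), ha⟩
  rw [mul_smul, ← hb, ← ha, one_smul]

/-- Coordinates are unique locally, hence uniquely determined since `O_X` is separated; uniqueness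
lets local coordinates glue to global ones. -/
lemma isFrame_of_locally (hL : L.presheaf.IsSheaf) {U : Opens X.carrier} {e : L.Sec U}
    (h : ∀ x ∈ U, ∃ (V : Opens X.carrier) (hV : V ≤ U), x ∈ V ∧ IsFrame (L.res hV e)) :
    IsFrame e := by
  intro V hV
  have loc : ∀ x ∈ V, ∃ (W : Opens X.carrier) (hW : W ≤ V), x ∈ W ∧
      IsFrame (L.res (hW.trans hV) e) := by
    intro x hx
    obtain ⟨W, hW, hxW, he⟩ := h x (hV hx)
    refine ⟨W ⊓ V, inf_le_right, ⟨hxW, hx⟩, ?_⟩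
    have := he.res (inf_le_left : W ⊓ V ≤ W)
    rwa [res_res] at this
  have inj : ∀ {W : Opens X.carrier} (hW : W ≤ V) (a b : X.Sec W),
      a • L.res (hW.trans hV) e = b • L.res (hW.trans hV) e → a = b := by
    intro W hW a b hab
    refine sec_ext fun x hx => ?_
    obtain ⟨T, hT, hxT, he⟩ := loc x (hW hx)
    refine ⟨T ⊓ W, inf_le_right, ⟨hxT, hx⟩, he.smul_cancel inf_le_left ?_⟩
    have := congrArg (L.res (inf_le_right : T ⊓ W ≤ W)) hab
    rw [res_smul, res_smul, res_res] at this
    rwa [res_res]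
  refine ⟨fun a b hab => inj le_rfl a b hab, fun s => ?_⟩
  have ex : ∀ x ∈ V, ∃ W : Opens X.carrier, W ≤ V ∧ x ∈ W ∧ ∃ t : X.Sec W, ∃ hW : W ≤ V,
      L.res hW s = t • L.res (hW.trans hV) e := by
    intro x hx
    obtain ⟨W, hW, hxW, he⟩ := loc x hx
    obtain ⟨a, ha⟩ := he.exists_smul le_rfl (L.res hW s)
    rw [res_res] at ha
    exact ⟨W, hW, hxW, a, hW, ha⟩
  obtain ⟨a, ha⟩ := sec_glue _ ex (by
    rintro W W' t t' ⟨hW, ht⟩ ⟨hW', ht'⟩ T hT hT'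
    have e1 := congrArg (L.res hT) ht
    have e2 := congrArg (L.res hT') ht'
    rw [res_smul, res_res, res_res] at e1 e2
    exact inj (hT.trans hW) _ _ (e1.symm.trans e2))
  refine ⟨a, ext_local hL fun x hx => ?_⟩
  obtain ⟨W, hW, hxW, t, ht⟩ := ex x hx
  refine ⟨W, hW, hxW, ?_⟩
  dsimp only
  rw [res_smul, res_res, ha W hW t ht]
  exact ht.2.symm

end OSet

end

section

variable {X : MonoidScheme.{u}}

open OSet MonoidScheme

/-! ### Frames matched with sections of `sM_X^*` -/

/-- `R` matches sections of `sM_X^*` with frames of `L`, in such a way that there are matched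
pairs near every point, with the same coordinate changes. -/
structure FrameRep (L : LineBundle X)
    (R : ∀ U : Opens X.carrier, X.SMerUnits U → L.Sec U → Prop) : Prop where
  frame : ∀ U f e, R U f e → IsFrame e
  cover : ∀ x : X.carrier, ∃ U, x ∈ U ∧ ∃ f e, R U f e
  compat : ∀ U f e V f' e', R U f e → R V f' e' →
    ∀ (W : Opens X.carrier) (hU : W ≤ U) (hV : W ≤ V) (g : (X.Sec W)ˣ),
      L.res hU e = (g : X.Sec W) • L.res hV e' →
        X.sMerRes hU f = X.unitsToSMer W g * X.sMerRes hV f'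

namespace FrameRep

variable {L : LineBundle X} {R : ∀ U : Opens X.carrier, X.SMerUnits U → L.Sec U → Prop}

/-- At each point take the class of some matched section. The choice does not matter, because the
coordinate changes are units of `O_X`, which are trivial in the quotient. -/
lemma exists_sDivisor (H : FrameRep L R) :
    ∃ D : X.SDivisor, ∀ U f e, R U f e → X.Represents D.1 f := by
  choose U hU f e h using H.cover
  have key : ∀ V f' e', R V f' e' →
      X.Represents (fun x => X.sDivGerm x (hU x) (f x)) f' := by
    intro V f' e' h' x hx
    obtain ⟨g, hg⟩ := (H.frame _ _ _ (h x)).exists_unit (H.frame _ _ _ h')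
      (inf_le_left : U x ⊓ V ≤ U x) inf_le_right
    have := H.compat _ _ _ _ _ _ (h x) h' _ _ _ g hg
    have hx' : x ∈ U x ⊓ V := ⟨hU x, hx⟩
    have e1 := congrArg (X.sDivGerm x hx') this
    rw [map_mul, sDivGerm_units, one_mul, X.sDivGerm_res, X.sDivGerm_res] at e1
    exact e1
  exact ⟨⟨_, fun x => ⟨U x, hU x, f x, key _ _ _ (h x)⟩⟩, key⟩

/-- Near each point a representative is `f = g f'` with `(f', e')` matched, and the frame of `f` has
to be `g e'`. The equality of coordinate changes makes this independent of the matched pair. -/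
lemma isAssociated (H : FrameRep L R) {D : X.SDivisor}
    (hD : ∀ U f e, R U f e → X.Represents D.1 f) : X.IsAssociated D L := by
  -- The section `s` is required to be right against every matched pair on every smaller open set;
  -- equivariance and compatibility with restriction then follow by local comparison.
  have ex : ∀ (U : Opens X.carrier) (f : X.SMerUnits U), X.Represents D.1 f →
      ∃ s : L.Sec U, ∀ (V : Opens X.carrier) (f' : X.SMerUnits V) (e' : L.Sec V), R V f' e' →
        ∀ (W : Opens X.carrier) (hU : W ≤ U) (hV : W ≤ V) (g : (X.Sec W)ˣ),
          X.sMerRes hU f = X.unitsToSMer W g * X.sMerRes hV f' →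
            L.res hU s = (g : X.Sec W) • L.res hV e' := by
    intro U f hf
    have := OSet.glue (U := U) L.isSheaf
      (fun W t => ∃ (V : Opens X.carrier) (f' : X.SMerUnits V) (e' : L.Sec V)
        (hU : W ≤ U) (hV : W ≤ V) (g : (X.Sec W)ˣ), R V f' e' ∧
          X.sMerRes hU f = X.unitsToSMer W g * X.sMerRes hV f' ∧
            t = (g : X.Sec W) • L.res hV e') ?_ ?_
    · obtain ⟨s, hs⟩ := this
      exact ⟨s, fun V f' e' h W hU hV g hg => hs W hU _ ⟨V, f', e', hU, hV, g, h, hg, rfl⟩⟩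
    · intro x hx
      obtain ⟨V, hxV, f', e', h⟩ := H.cover x
      obtain ⟨g, hg⟩ := (hf.res X (inf_le_left : U ⊓ V ≤ U)).exists_unit
        ((hD V f' e' h).res X (inf_le_right : U ⊓ V ≤ V))
      exact ⟨U ⊓ V, inf_le_left, ⟨hx, hxV⟩, _, V, f', e', inf_le_left, inf_le_right, g, h, hg, rfl⟩
    · rintro W W' _ _ ⟨V, f₁, e₁, hU, hV, g, h, hg, rfl⟩ ⟨V', f₂, e₂, hU', hV', g', h', hg', rfl⟩
        T hT hT'
      obtain ⟨k, hk⟩ := (H.frame _ _ _ h).exists_unit (H.frame _ _ _ h')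
        (hT.trans hV) (hT'.trans hV')
      have hk' := H.compat _ _ _ _ _ _ h h' T _ _ k hk
      have e1 := congrArg (X.sMerRes hT) hg
      have e2 := congrArg (X.sMerRes hT') hg'
      rw [map_mul, sMerRes_res, sMerRes_res, sMerRes_units] at e1 e2
      rw [hk', ← mul_assoc, ← map_mul] at e1
      have e3 := unitsToSMer_injective T (mul_right_cancel (e1.symm.trans e2))
      -- Cocycle relation: `f = g f₁ = g k f₂` and `f = g' f₂` give `g k = g'` in `O_X^*`.
      have e4 : X.res hT (g : X.Sec W) * (k : X.Sec T) = X.res hT' (g' : X.Sec W') :=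
        congrArg Units.val e3
      rw [res_smul, res_smul, OSet.res_res, OSet.res_res, hk, ← mul_smul, e4]
  choose τ hτ using ex
  have loc : ∀ (U : Opens X.carrier) (f : X.SMerUnits U), X.Represents D.1 f → ∀ x ∈ U,
      ∃ (V : Opens X.carrier) (f' : X.SMerUnits V) (e' : L.Sec V) (W : Opens X.carrier)
        (hU : W ≤ U) (hV : W ≤ V) (g : (X.Sec W)ˣ), R V f' e' ∧ x ∈ W ∧
          X.sMerRes hU f = X.unitsToSMer W g * X.sMerRes hV f' := by
    intro U f hf x hx
    obtain ⟨V, hxV, f', e', h⟩ := H.cover x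
    obtain ⟨g, hg⟩ := (hf.res X (inf_le_left : U ⊓ V ≤ U)).exists_unit
      ((hD V f' e' h).res X (inf_le_right : U ⊓ V ≤ V))
    exact ⟨V, f', e', U ⊓ V, inf_le_left, inf_le_right, g, h, ⟨hx, hxV⟩, hg⟩
  refine ⟨τ, fun U f hf => ?_, fun U g f hf hgf => ?_, fun U V h f hf => ?_⟩
  · refine isFrame_of_locally L.isSheaf fun x hx => ?_
    obtain ⟨V, f', e', W, hU, hV, g, h, hxW, hg⟩ := loc U f hf x hx
    refine ⟨W, hU, hxW, ?_⟩
    rw [hτ U f hf V f' e' h W hU hV g hg]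
    exact ((H.frame _ _ _ h).res hV).units_smul g
  · refine ext_local L.isSheaf fun x hx => ?_
    obtain ⟨V, f', e', W, hU, hV, k, h, hxW, hk⟩ := loc U f hf x hx
    refine ⟨W, hU, hxW, ?_⟩
    rw [res_smul, hτ U f hf V f' e' h W hU hV k hk,
      hτ U _ hgf V f' e' h W hU hV (Units.map (X.res hU) g * k) (by
        rw [map_mul, hk, sMerRes_units, map_mul, mul_assoc]), ← mul_smul]
    rfl
  · refine ext_local L.isSheaf fun x hx => ?_
    obtain ⟨V', f', e', W, hV, hV', k, h', hxW, hk⟩ := loc V _ (hf.res X h) x hx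
    refine ⟨W, hV, hxW, ?_⟩
    rw [hτ V _ (hf.res X h) V' f' e' h' W hV hV' k hk, OSet.res_res,
      hτ U f hf V' f' e' h' W (hV.trans h) hV' k hk]

end FrameRep

/-! ### Uniqueness, multiplicativity and triviality of associated line bundles -/

/-- The matching given by the sections of `sM_X^*` that represent an `s`-divisor. -/
lemma MonoidScheme.IsAssociated.exists_frameRep {D : X.SDivisor} {L : LineBundle X}
    (h : X.IsAssociated D L) : ∃ R : ∀ U : Opens X.carrier, X.SMerUnits U → L.Sec U → Prop,
      FrameRep L R ∧ (∀ U f e, R U f e → X.Represents D.1 f) ∧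
      (∀ U f, X.Represents D.1 f → ∃ e, R U f e) ∧
      ∀ U V f e (h : V ≤ U), R U f e → R V (X.sMerRes h f) (L.res h e) := by
  obtain ⟨τ, h1, h2, h3⟩ := h
  refine ⟨fun U f e => ∃ hf : X.Represents D.1 f, e = τ U f hf, ⟨?_, ?_, ?_⟩, ?_, ?_, ?_⟩
  · rintro U f _ ⟨hf, rfl⟩
    exact h1 U f hf
  · intro x
    obtain ⟨U, hU, f, hf⟩ := D.2 x
    exact ⟨U, hU, f, _, hf, rfl⟩
  · rintro U f _ V f' _ ⟨hf, rfl⟩ ⟨hf', rfl⟩ W hU hV g hg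
    obtain ⟨k, hk⟩ := (hf.res X hU).exists_unit (hf'.res X hV)
    -- The section is kept as a variable with an equation, since `τ` also takes a proof about it.
    have e1 : ∀ (s : X.SMerUnits W) (hs : X.Represents D.1 s),
        s = X.unitsToSMer W k * X.sMerRes hV f' →
          τ W s hs = (k : X.Sec W) • τ W _ (hf'.res X hV) := by
      rintro _ hs rfl
      exact h2 W k _ _ hs
    have e2 := e1 _ (hf.res X hU) hk
    rw [h3 U W hU f hf, h3 V W hV f' hf', hg] at e2
    rw [hk, show g = k from Units.ext ((h1 V f' hf').smul_cancel hV e2)]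
  · rintro U f _ ⟨hf, -⟩
    exact hf
  · exact fun U f hf => ⟨_, hf, rfl⟩
  · rintro U V f _ h ⟨hf, rfl⟩
    exact ⟨hf.res X h, (h3 U V h f hf).symm⟩

/-- Line bundles associated to the same `s`-divisor are isomorphic. -/
lemma MonoidScheme.IsAssociated.iso {D : X.SDivisor} {L L' : LineBundle X}
    (h : X.IsAssociated D L) (h' : X.IsAssociated D L') : LineBundle.Iso L L' := by
  obtain ⟨R, H, hR, hR', -⟩ := h.exists_frameRep
  obtain ⟨S, K, hS, hS', -⟩ := h'.exists_frameRep
  -- Two frames correspond when they come from the same representative of `D`.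
  refine LineBundle.FrameMatch.iso (R := fun U e e' => ∃ f, R U f e ∧ S U f e') ⟨?_, ?_, ?_⟩
  · rintro U e e' ⟨f, hf, hf'⟩
    exact ⟨H.frame _ _ _ hf, K.frame _ _ _ hf'⟩
  · intro x
    obtain ⟨U, hU, f, hf⟩ := D.2 x
    obtain ⟨e, he⟩ := hR' U f hf
    obtain ⟨e', he'⟩ := hS' U f hf
    exact ⟨U, hU, e, e', f, he, he'⟩
  · rintro U e e' V d d' ⟨f, he, he'⟩ ⟨k, hd, hd'⟩ W hU hV a ha
    -- The coordinate `a` is a unit and can be compared in `sM_X^*`: the coordinate changes of `L`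
    -- and of `L'` both map to the quotient of `f` by `k`.
    obtain ⟨g, hg⟩ := (H.frame _ _ _ he).exists_unit (H.frame _ _ _ hd) hU hV
    obtain rfl := (H.frame _ _ _ hd).smul_cancel hV (ha.symm.trans hg)
    have e1 := H.compat _ _ _ _ _ _ he hd W hU hV g hg
    obtain ⟨g', hg'⟩ := (K.frame _ _ _ he').exists_unit (K.frame _ _ _ hd') hU hV
    have e2 := K.compat _ _ _ _ _ _ he' hd' W hU hV g' hg'
    rw [hg', unitsToSMer_injective W (mul_right_cancel (e1.symm.trans e2))]

lemma LineBundle.Iso.isAssociated {D : X.SDivisor} {L L' : LineBundle X} (i : LineBundle.Iso L L')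
    (h : X.IsAssociated D L) : X.IsAssociated D L' := by
  obtain ⟨i⟩ := i
  obtain ⟨τ, h1, h2, h3⟩ := h
  refine ⟨fun U f hf => i.equiv U le_top (τ U f hf), fun U f hf V hV => ?_, fun U g f hf hgf => ?_,
    fun U V h f hf => ?_⟩
  · suffices key : (fun a : X.Sec V => a • L'.res hV (i.equiv U le_top (τ U f hf))) =
        i.equiv V le_top ∘ fun a : X.Sec V => a • L.res hV (τ U f hf) by
      rw [key]
      exact (i.equiv V le_top).bijective.comp (h1 U f hf V hV)
    funext a
    rw [Function.comp_apply, i.map_smul, i.map_res U V le_top hV]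
  · dsimp only
    rw [h2 U g f hf hgf, i.map_smul]
  · dsimp only
    rw [h3 U V h f hf, i.map_res U V le_top h]

/-- Products `f f'` are matched with `e ⊗ e'`, and the coordinate changes multiply on both sides.
Stability of the matchings under restriction provides factors on a common open set. -/
lemma MonoidScheme.IsAssociated.mul {D D' : X.SDivisor} {L L' : LineBundle X}
    (h : X.IsAssociated D L) (h' : X.IsAssociated D' L') :
    X.IsAssociated (D * D') (L.tensor L') := by
  obtain ⟨R, H, hR, -, hR'⟩ := h.exists_frameRep
  obtain ⟨S, K, hS, -, hS'⟩ := h'.exists_frameRep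
  refine FrameRep.isAssociated (R := fun U k t => ∃ f e f' e', R U f e ∧ S U f' e' ∧ k = f * f' ∧
    t = LineBundle.tmul e e') ⟨?_, ?_, ?_⟩ ?_
  · rintro U _ _ ⟨f, e, f', e', h, h', rfl, rfl⟩
    exact (H.frame _ _ _ h).tmul (K.frame _ _ _ h')
  · intro x
    obtain ⟨U, hU, f, e, hf⟩ := H.cover x
    obtain ⟨V, hV, f', e', hf'⟩ := K.cover x
    exact ⟨U ⊓ V, ⟨hU, hV⟩, _, _, _, _, _, _, hR' _ _ _ _ inf_le_left hf,
      hS' _ _ _ _ inf_le_right hf',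
      rfl, rfl⟩
  · rintro U _ _ V _ _ ⟨f, e, f', e', hf, hf', rfl, rfl⟩ ⟨k, d, k', d', hk, hk', rfl, rfl⟩
      W hU hV g hg
    obtain ⟨a, ha⟩ := (H.frame _ _ _ hf).exists_unit (H.frame _ _ _ hk) hU hV
    obtain ⟨b, hb⟩ := (K.frame _ _ _ hf').exists_unit (K.frame _ _ _ hk') hU hV
    rw [LineBundle.tmul_coord hU hV ha hb] at hg
    obtain rfl : a * b = g :=
      Units.ext (((H.frame _ _ _ hk).tmul (K.frame _ _ _ hk')).smul_cancel hV hg)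
    rw [map_mul, map_mul, map_mul, H.compat _ _ _ _ _ _ hf hk W hU hV a ha,
      K.compat _ _ _ _ _ _ hf' hk' W hU hV b hb]
    ac_rfl
  · rintro U _ _ ⟨f, e, f', e', hf, hf', rfl, rfl⟩ x hx
    rw [map_mul]
    exact congrArg₂ (· * ·) (hR _ _ _ hf x hx) (hS _ _ _ hf' x hx)

variable (X) in
/-- The unit section of the trivial line bundle. -/
def LineBundle.one (U : Opens X.carrier) : (LineBundle.trivial X).Sec U := (1 : X.Sec U)

lemma LineBundle.one_res {U V : Opens X.carrier} (h : V ≤ U) :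
    (LineBundle.trivial X).res h (LineBundle.one X U) = LineBundle.one X V := map_one (X.res h)

lemma LineBundle.isFrame_one (U : Opens X.carrier) : IsFrame (LineBundle.one X U) :=
  OSet.isFrame_one X U

/-- The principal divisors are those of the trivial line bundle. -/
lemma MonoidScheme.isAssociated_trivial_iff {D : X.SDivisor} :
    X.IsAssociated D (LineBundle.trivial X) ↔ D ∈ X.principal.range := by
  constructor
  · intro h
    obtain ⟨R, H, hR, -⟩ := h.exists_frameRep
    -- The global representative is the section that corresponds to the frame `1`: wherever `1 = g
    -- e` with `(f, e)` matched, it is `g f`.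
    have ex : ∀ x ∈ (⊤ : Opens X.carrier), ∃ V : Opens X.carrier, V ≤ ⊤ ∧ x ∈ V ∧
        ∃ t : X.SMerUnits V, ∃ (U : Opens X.carrier) (f : X.SMerUnits U)
          (e : (LineBundle.trivial X).Sec U) (hV : V ≤ U) (g : (X.Sec V)ˣ), R U f e ∧
            (LineBundle.trivial X).res le_top (LineBundle.one X ⊤) =
              (g : X.Sec V) • (LineBundle.trivial X).res hV e ∧
            t = X.unitsToSMer V g * X.sMerRes hV f := by
      intro x _
      obtain ⟨U, hU, f, e, hf⟩ := H.cover x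
      obtain ⟨g, hg⟩ := (LineBundle.isFrame_one ⊤).exists_unit
        (H.frame _ _ _ hf) le_top (le_refl U)
      exact ⟨U, le_top, hU, _, U, f, e, le_rfl, g, hf, hg, rfl⟩
    obtain ⟨s, hs⟩ := sMer_glue _ ex (by
      rintro V V' _ _ ⟨U, f, e, hV, g, hf, hg, rfl⟩ ⟨U', f', e', hV', g', hf', hg', rfl⟩ W hW hW'
      obtain ⟨k, hk⟩ := (H.frame _ _ _ hf).exists_unit (H.frame _ _ _ hf') (hW.trans hV)
        (hW'.trans hV')
      have e1 := congrArg ((LineBundle.trivial X).res hW) hg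
      have e2 := congrArg ((LineBundle.trivial X).res hW') hg'
      rw [res_smul, OSet.res_res, OSet.res_res, hk, ← mul_smul] at e1
      rw [res_smul, OSet.res_res, OSet.res_res] at e2
      have e3 := (H.frame _ _ _ hf').smul_cancel _ (e1.symm.trans e2)
      rw [map_mul, map_mul, sMerRes_units, sMerRes_units, sMerRes_res, sMerRes_res,
        H.compat _ _ _ _ _ _ hf hf' W _ _ k hk, ← mul_assoc, ← map_mul]
      congr 2
      exact Units.ext e3)
    refine ⟨s, Subtype.ext (funext fun x => ?_)⟩
    obtain ⟨V, hV, hxV, t, ht⟩ := ex x (Opens.mem_top x)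
    have hst := hs V hV t ht
    obtain ⟨U, f, e, hVU, g, hf, -, rfl⟩ := ht
    rw [((hR _ _ _ hf).res X hVU).unit_mul g x hxV, ← hst, X.sDivGerm_res]
    rfl
  · rintro ⟨f, rfl⟩
    -- Only restrictions of the one section `f` are matched, each with `1`, so every coordinate
    -- change is `1`.
    refine FrameRep.isAssociated (R := fun U k e => k = X.sMerRes le_top f ∧ e = LineBundle.one X U)
      ⟨?_, ?_, ?_⟩ ?_
    · rintro U _ _ ⟨-, rfl⟩
      exact LineBundle.isFrame_one U
    · exact fun x => ⟨⊤, Opens.mem_top x, _, _, rfl, rfl⟩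
    · rintro U _ _ V _ _ ⟨rfl, rfl⟩ ⟨rfl, rfl⟩ W hU hV g hg
      rw [LineBundle.one_res, LineBundle.one_res] at hg
      have h1 : (g : X.Sec W) = 1 := (LineBundle.isFrame_one W).smul_cancel le_rfl (by
        rw [LineBundle.one_res, ← hg, one_smul])
      obtain rfl : g = 1 := Units.ext h1
      rw [map_one, one_mul, sMerRes_res, sMerRes_res]
    · rintro U _ _ ⟨rfl, rfl⟩ x hx
      exact (X.sDivGerm_res le_top x hx f).symm

end

section

variable {X : MonoidScheme.{u}}

open OSet MonoidScheme

/-! ### The line bundle of an `s`-divisor, constructed -/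

/-- A function on the representatives of `D` over open subsets of `U`, equivariant for
the inverse action of the units of `O_X`. -/
@[ext]
structure DivSec (D : X.SDivisor) (U : Opens X.carrier) : Type u where
  toFun : ∀ V : Opens X.carrier, V ≤ U → ∀ f : X.SMerUnits V, X.Represents D.1 f → X.Sec V
  map_unit : ∀ V hV (g : (X.Sec V)ˣ) (f : X.SMerUnits V) (hf : X.Represents D.1 f)
    (hgf : X.Represents D.1 (X.unitsToSMer V g * f)),
    toFun V hV (X.unitsToSMer V g * f) hgf * (g : X.Sec V) = toFun V hV f hf
  map_res : ∀ V W (hV : V ≤ U) (hW : W ≤ V) (f : X.SMerUnits V) (hf : X.Represents D.1 f),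
    toFun W (hW.trans hV) (X.sMerRes hW f) (hf.res X hW) = X.res hW (toFun V hV f hf)

namespace DivSec

variable {D : X.SDivisor}

lemma ext' {U : Opens X.carrier} {s t : DivSec D U}
    (h : ∀ V hV f hf, s.toFun V hV f hf = t.toFun V hV f hf) : s = t :=
  DivSec.ext (funext fun V => funext fun hV => funext fun f => funext fun hf => h V hV f hf)

lemma apply_eq {U : Opens X.carrier} {s t : DivSec D U} (h : s = t) {V : Opens X.carrier}
    (hV : V ≤ U) (f : X.SMerUnits V) (hf : X.Represents D.1 f) :
    s.toFun V hV f hf = t.toFun V hV f hf := by rw [h]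

instance (U : Opens X.carrier) : MulAction (X.Sec U) (DivSec D U) where
  smul a s := ⟨fun V hV f hf => X.res hV a * s.toFun V hV f hf,
    fun V hV g f hf hgf => by rw [mul_assoc, s.map_unit],
    fun V W hV hW f hf => by rw [s.map_res V W hV hW, map_mul, MonoidScheme.res_res]⟩
  one_smul s := ext' fun V hV f hf => by
    change X.res hV 1 * s.toFun V hV f hf = _
    rw [map_one, one_mul]
  mul_smul a b s := ext' fun V hV f hf => by
    change X.res hV (a * b) * s.toFun V hV f hf = X.res hV a * (X.res hV b * s.toFun V hV f hf)
    rw [map_mul, mul_assoc]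

end DivSec

variable (D : X.SDivisor)

/-- The presheaf of sections of the line bundle of `D`. -/
def divSet : OSet X where
  presheaf :=
    { obj := fun U => DivSec D U.unop
      map := fun {U V} i => ↾(fun s => ⟨fun W hW f hf => s.toFun W (hW.trans i.unop.le) f hf,
        fun W hW g f hf hgf => s.map_unit W _ g f hf hgf,
        fun W T hW hT f hf => s.map_res W T _ hT f hf⟩) }
  act U := (inferInstance : MulAction (X.Sec U) (DivSec D U))
  map_smul {U V} h a s := DivSec.ext' fun W hW f hf => by
    change X.res (hW.trans h) a * _ = X.res hW (X.res h a) * _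
    rw [MonoidScheme.res_res]
    rfl

/-- A function on representatives over `V` is determined by its values on their restrictions to the
members of a cover of `V`, so gluing reduces to gluing its values in `O_X`. -/
lemma divSet_isSheaf : (divSet D).presheaf.IsSheaf := by
  refine TopCat.Presheaf.isSheaf_of_isSheafUniqueGluing_types _ fun {ι} U φ hφ => ?_
  let ψ : ∀ i, DivSec D (U i) := φ
  have hψ : ∀ (i j : ι) (W : Opens X.carrier) (hi : W ≤ U i) (hj : W ≤ U j) (f : X.SMerUnits W)
      (hf : X.Represents D.1 f), (ψ i).toFun W hi f hf = (ψ j).toFun W hj f hf :=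
    fun i j W hi hj f hf => DivSec.apply_eq (U := U i ⊓ U j) (hφ i j) (le_inf hi hj) f hf
  have cov : ∀ V : Opens X.carrier, V ≤ iSup U → ∀ x ∈ V, ∃ i, x ∈ U i := fun V hV x hx =>
    Opens.mem_iSup.1 (hV hx)
  -- A representative over `V` need not live over a single `U i`; its value is glued from the values
  -- on its restrictions.
  have ex : ∀ (V : Opens X.carrier) (_ : V ≤ iSup U) (f : X.SMerUnits V)
      (hf : X.Represents D.1 f), ∃ a : X.Sec V,
        ∀ (i : ι) (W : Opens X.carrier) (hi : W ≤ U i) (hW : W ≤ V),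
          X.res hW a = (ψ i).toFun W hi (X.sMerRes hW f) (hf.res X hW) := by
    intro V hV f hf
    obtain ⟨a, ha⟩ := sec_glue (U := V) (fun W t => ∃ (i : ι) (hi : W ≤ U i) (hW : W ≤ V),
      t = (ψ i).toFun W hi (X.sMerRes hW f) (hf.res X hW)) (by
        intro x hx
        obtain ⟨i, hi⟩ := cov V hV x hx
        exact ⟨U i ⊓ V, inf_le_right, ⟨hi, hx⟩, _, i, inf_le_left, inf_le_right, rfl⟩) (by
        rintro W W' _ _ ⟨i, hi, hW, rfl⟩ ⟨j, hj, hW', rfl⟩ T hT hT'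
        rw [← (ψ i).map_res W T hi hT, ← (ψ j).map_res W' T hj hT']
        exact hψ i j T _ _ _ _)
    exact ⟨a, fun i W hi hW => ha W hW _ ⟨i, hi, hW, rfl⟩⟩
  choose F hF using ex
  have uniq : ∀ (V : Opens X.carrier) (hV : V ≤ iSup U) (a b : X.Sec V),
      (∀ (i : ι) (W : Opens X.carrier) (_ : W ≤ U i) (hW : W ≤ V), X.res hW a = X.res hW b) →
        a = b := by
    intro V hV a b h
    refine sec_ext fun x hx => ?_
    obtain ⟨i, hi⟩ := cov V hV x hx
    exact ⟨U i ⊓ V, inf_le_right, ⟨hi, hx⟩, h i _ inf_le_left inf_le_right⟩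
  let Φ : DivSec D (iSup U) :=
    ⟨F, fun V hV g f hf hgf => uniq V hV _ _ fun i W hi hW => by
      have key : ∀ (k : X.SMerUnits W) (hk : X.Represents D.1 k),
          k = X.unitsToSMer W (Units.map (X.res hW) g) * X.sMerRes hW f →
            (ψ i).toFun W hi k hk * X.res hW (g : X.Sec V) =
              (ψ i).toFun W hi (X.sMerRes hW f) (hf.res X hW) := by
        rintro _ hk rfl
        exact (ψ i).map_unit W hi (Units.map (X.res hW) g) _ _ hk
      rw [map_mul, hF V hV _ hgf i W hi hW, hF V hV f hf i W hi hW]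
      exact key _ _ (by rw [map_mul, sMerRes_units]),
    fun V W hV hW f hf => uniq W (hW.trans hV) _ _ fun i T hi hT => by
      rw [hF W _ _ _ i T hi hT, MonoidScheme.res_res, hF V hV f hf i T hi (hT.trans hW)]
      rfl⟩
  refine ⟨Φ, fun i => ?_, fun Ψ hΨ => ?_⟩
  · refine DivSec.ext' fun V hV f hf => ?_
    have := hF V (hV.trans (le_iSup U i)) f hf i V hV le_rfl
    rw [MonoidScheme.res_refl] at this
    exact this
  · refine DivSec.ext' fun V hV f hf => ?_
    refine uniq V hV _ _ fun i W hi hW => ?_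
    have h1 := DivSec.apply_eq (U := U i) (hΨ i) hi (X.sMerRes hW f) (hf.res X hW)
    refine Eq.trans ?_ (hF V hV f hf i W hi hW).symm
    exact ((DivSec.map_res (show DivSec D (iSup U) from Ψ) V W hV hW f hf).symm).trans h1

variable {D}

/-- The frame given by a representative of `D`. -/
def divFrame {U : Opens X.carrier} (f : X.SMerUnits U) (hf : X.Represents D.1 f) : DivSec D U where
  -- The value at `k` is the unit `f / k`.
  toFun V hV k hk := (((hf.res X hV).exists_unit hk).choose : (X.Sec V)ˣ)
  map_unit V hV g k hk hgk := by
    rw [← Units.val_mul]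
    refine congrArg Units.val (unitsToSMer_injective V (mul_right_cancel (b := k) ?_))
    rw [map_mul, mul_assoc, ← ((hf.res X hV).exists_unit hgk).choose_spec,
      ← ((hf.res X hV).exists_unit hk).choose_spec]
  map_res V W hV hW k hk := by
    change _ = ((Units.map (X.res hW) _ : (X.Sec W)ˣ) : X.Sec W)
    refine congrArg Units.val (unitsToSMer_injective W
      (mul_right_cancel (b := X.sMerRes hW k) ?_))
    rw [← ((hf.res X (hW.trans hV)).exists_unit (hk.res X hW)).choose_spec, ← sMerRes_units,
      ← map_mul, ← ((hf.res X hV).exists_unit hk).choose_spec, sMerRes_res]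

/-- By injectivity of `O_X^* → sM_X^*` the chosen unit is the only one possible. -/
lemma divFrame_toFun {U V : Opens X.carrier} {f : X.SMerUnits U} (hf : X.Represents D.1 f)
    (hV : V ≤ U) {k : X.SMerUnits V} (hk : X.Represents D.1 k) {g : (X.Sec V)ˣ}
    (hg : X.sMerRes hV f = X.unitsToSMer V g * k) : (divFrame f hf).toFun V hV k hk = g :=
  congrArg Units.val (unitsToSMer_injective V (mul_right_cancel (b := k)
    (((hf.res X hV).exists_unit hk).choose_spec.symm.trans hg)))

/-- The frame has value `1` at `f` itself, so evaluation at `f` recovers the coefficient of a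
multiple. By equivariance every section is `s(f)` times the frame. -/
lemma isFrame_divFrame {U : Opens X.carrier} (f : X.SMerUnits U) (hf : X.Represents D.1 f) :
    IsFrame (L := divSet D) (show (divSet D).Sec U from divFrame f hf) := by
  intro V hV
  constructor
  · intro a b hab
    have h := DivSec.apply_eq (U := V) hab le_rfl (X.sMerRes hV f) (hf.res X hV)
    have h' : X.res le_rfl a * (divFrame f hf).toFun V hV (X.sMerRes hV f) (hf.res X hV) =
      X.res le_rfl b * (divFrame f hf).toFun V hV (X.sMerRes hV f) (hf.res X hV) := h
    rwa [divFrame_toFun hf hV (hf.res X hV) (g := 1) (by rw [map_one, one_mul]), Units.val_one,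
      mul_one, mul_one, MonoidScheme.res_refl, MonoidScheme.res_refl] at h'
  · intro s
    let t : DivSec D V := s
    refine ⟨t.toFun V le_rfl (X.sMerRes hV f) (hf.res X hV), DivSec.ext' fun W hW k hk => ?_⟩
    change X.res hW (t.toFun V le_rfl (X.sMerRes hV f) (hf.res X hV)) *
      (divFrame f hf).toFun W (hW.trans hV) k hk = t.toFun W hW k hk
    obtain ⟨g, hg⟩ := (hf.res X (hW.trans hV)).exists_unit hk
    rw [divFrame_toFun hf _ hk hg, ← t.map_res V W le_rfl hW]
    have key : ∀ (l : X.SMerUnits W) (hl : X.Represents D.1 l), l = X.unitsToSMer W g * k →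
        t.toFun W hW l hl * (g : X.Sec W) = t.toFun W hW k hk := by
      rintro _ hl rfl
      exact t.map_unit W hW g k hk hl
    exact key _ _ hg

variable (D) in
/-- The line bundle of an `s`-divisor. -/
def divBundle : LineBundle X where
  toOSet := divSet D
  isSheaf := divSet_isSheaf D
  locally_trivial x := by
    obtain ⟨U, hU, f, hf⟩ := D.2 x
    exact ⟨U, hU, ⟨(isFrame_divFrame f hf).isoOn⟩⟩

variable (D) in
lemma isAssociated_divBundle : X.IsAssociated D (divBundle D) := by
  refine ⟨fun U f hf => divFrame f hf, fun U f hf => isFrame_divFrame f hf,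
    fun U g f hf hgf => DivSec.ext' fun V hV k hk => ?_,
    fun U V h f hf => DivSec.ext' fun W hW k hk => ?_⟩
  · change _ = X.res hV (g : X.Sec U) * (divFrame f hf).toFun V hV k hk
    obtain ⟨u, hu⟩ := (hf.res X hV).exists_unit hk
    rw [divFrame_toFun hf hV hk hu, divFrame_toFun hgf hV hk (g := Units.map (X.res hV) g * u) (by
      rw [map_mul, hu, sMerRes_units, map_mul, mul_assoc])]
    rfl
  · change _ = (divFrame f hf).toFun W (hW.trans h) k hk
    obtain ⟨u, hu⟩ := (hf.res X (hW.trans h)).exists_unit hk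
    rw [divFrame_toFun hf _ hk hu, divFrame_toFun (hf.res X h) hW hk hu]

/-- The bundles associated to `D` form exactly one isomorphism class. Hence a statement about the
class of `divBundle D` may be checked on any associated bundle. -/
lemma Pic.mk_eq_mk_divBundle_iff {L : LineBundle X} :
    Pic.mk (divBundle D) = Pic.mk L ↔ X.IsAssociated D L :=
  ⟨fun h => LineBundle.Iso.isAssociated (Quotient.exact h) (isAssociated_divBundle D),
    fun h => Quotient.sound ((isAssociated_divBundle D).iso h)⟩

/-! ### The homomorphism from divisor classes to the Picard group -/

variable (X) in
/-- The homomorphism from `s`-divisors to the Picard group. -/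
def divHom : X.SDivisor →* Pic X where
  toFun D := Pic.mk (divBundle D)
  map_one' := Pic.mk_eq_mk_divBundle_iff.2 (isAssociated_trivial_iff.2 (one_mem _))
  map_mul' D D' := Pic.mk_eq_mk_divBundle_iff.2
    ((isAssociated_divBundle D).mul (isAssociated_divBundle D'))

lemma ker_divHom : (divHom X).ker = X.principal.range := by
  ext D
  exact Pic.mk_eq_mk_divBundle_iff.trans isAssociated_trivial_iff

variable (X) in
/-- The homomorphism `sCl(X) → Pic(X)`. -/
def sClHom : X.SCl →* Pic X := QuotientGroup.lift _ (divHom X) ker_divHom.ge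

lemma sClHom_mk_eq_iff {L : LineBundle X} :
    sClHom X (QuotientGroup.mk D) = Pic.mk L ↔ X.IsAssociated D L := Pic.mk_eq_mk_divBundle_iff

lemma sClHom_injective : Function.Injective (sClHom X) := by
  refine (injective_iff_map_eq_one _).2 fun c hc => ?_
  induction c using QuotientGroup.induction_on with
  | H D => exact (QuotientGroup.eq_one_iff D).2 (ker_divHom.le hc)

end

section

/-! ### Points and stalks of `Spec M` -/

/-- Generalisations are smaller primes, so the empty prime is the generic point of `Spec M`. It is
enough to test the generating open sets `D(f)`. -/
lemma PrimeIdeal.specializes_iff {M : Type u} [CommMonoid M] {q p : PrimeIdeal M} :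
    q ⤳ p ↔ q.carrier ⊆ p.carrier := by
  rw [specializes_iff_forall_open]
  constructor
  · intro h f hf
    by_contra hp
    exact h _ (isOpen_D f) hp hf
  · intro h s hs
    induction hs with
    | basic s hs =>
      obtain ⟨f, rfl⟩ := hs
      exact fun hp hq => hp (h hq)
    | univ => exact fun _ => trivial
    | inter s t _ _ ihs iht => exact fun hp => ⟨ihs hp.1, iht hp.2⟩
    | sUnion S _ ih =>
      rintro ⟨s, hs, hp⟩
      exact ⟨s, hs, ih s hs hp⟩

instance {M : Type u} [CommMonoid M] : T0Space (PrimeIdeal M) := by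
  refine ⟨fun p q h => PrimeIdeal.ext ?_⟩
  exact (PrimeIdeal.specializes_iff.1 h.specializes).antisymm
    (PrimeIdeal.specializes_iff.1 h.symm.specializes)

/-- The empty prime ideal. -/
def PrimeIdeal.empty (M : Type u) [CommMonoid M] : PrimeIdeal M where
  carrier := ∅
  mul_mem _ _ h := h.elim
  one_notMem h := h
  mem_or_mem h := h.elim

/-- The largest prime ideal contained in `p` that does not contain `a`. -/
def PrimeIdeal.avoid {M : Type u} [CommMonoid M] (p : PrimeIdeal M) (a : M) : PrimeIdeal M where
  -- The complement consists of the divisors of the elements `s a^n` with `s ∉ p`: it is the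
  -- saturated submonoid generated by `a` and the complement of `p`.
  carrier := {m | ∀ (n : ℕ), ∀ s ∉ p.carrier, ¬ m ∣ s * a ^ n}
  mul_mem b c h n s hs hd := h n s hs ((Dvd.intro_left b rfl).trans hd)
  one_notMem h := h 0 1 p.one_notMem (one_dvd _)
  mem_or_mem := by
    intro b c h
    by_contra! H
    simp only [Set.mem_ofPred_eq, not_forall, not_not] at H
    obtain ⟨⟨n, s, hs, hb⟩, ⟨k, t, ht, hc⟩⟩ := H
    refine h (n + k) (s * t) (fun h' => (p.mem_or_mem h').elim hs ht) ?_
    rw [pow_add, mul_mul_mul_comm]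
    exact mul_dvd_mul hb hc

/-- The canonical map from `M` to the stalk of `Spec M` at `x`. -/
def toSpecStalk (M : CommMonCat.{u}) (x : Spec M) : M →* (Spec M).presheaf.stalk x where
  toFun m := fracGerm M x m 1 (PrimeIdeal.one_notMem x)
  map_one' := fracGerm_one M x
  map_mul' a b := by
    rw [fracGerm_mul]
    exact fracGerm_eq _ _ _ _ _ _ _ _ (by simp)

lemma fracGerm_mul_toSpecStalk (M : CommMonCat.{u}) (x : Spec M) (a f : M)
    (hf : f ∉ PrimeIdeal.carrier x) :
    fracGerm M x a f hf * toSpecStalk M x f = toSpecStalk M x a := by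
  refine (fracGerm_mul _ _ _ _ _ _ _ _).trans (fracGerm_eq _ _ _ _ _ _ _ _ ?_)
  simp [mul_comm]

/-- If `m · (b / g) = 1` at `x`, then `d m b = d g` for some `d` outside the prime; with `m` in the
prime this would put `d` or `g` into it. -/
lemma isUnit_toSpecStalk (M : CommMonCat.{u}) (x : Spec M) (m : M) :
    IsUnit (toSpecStalk M x m) ↔ m ∉ PrimeIdeal.carrier x := by
  constructor
  · intro h hm
    obtain ⟨c, hc⟩ := h.exists_right_inv
    obtain ⟨b, g, hg, rfl⟩ := exists_eq_fracGerm M x c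
    have h1 : fracGerm M x (m * b) (1 * g) (fun h => (PrimeIdeal.mem_or_mem x h).elim
        (PrimeIdeal.one_notMem x) hg) = fracGerm M x 1 1 (PrimeIdeal.one_notMem x) :=
      (fracGerm_mul _ _ _ _ _ _ _ _).symm.trans (hc.trans (fracGerm_one M x).symm)
    obtain ⟨W, hW, i, j, e⟩ := TopCat.Presheaf.germ_eq _ x _ _ _ _ h1
    have e' := congrFun (congrArg Subtype.val e) ⟨x, hW⟩
    obtain ⟨d, hd⟩ := Localization.r_iff_exists.1 (Localization.mk_eq_mk_iff.1 e')
    have hd' : ∀ d' : M, d' * (1 * (m * b)) = d' * (1 * g * 1) → d' * (m * b) = d' * g := by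
      intro d' h'
      rwa [one_mul, one_mul, mul_one] at h'
    have : d.1 * g ∈ PrimeIdeal.carrier x := by
      rw [← hd' d.1 hd, mul_comm m b]
      exact PrimeIdeal.mul_mem x _ (PrimeIdeal.mul_mem x _ hm)
    exact (PrimeIdeal.mem_or_mem x this).elim d.2 hg
  · intro hm
    refine IsUnit.of_mul_eq_one_right (fracGerm M x 1 m hm) ?_
    rw [fracGerm_mul_toSpecStalk, map_one]

/-! ### Charts -/

section

open AlgebraicGeometry

variable {Y Z W : PresheafedSpace CommMonCat.{u}} (α : Y ⟶ Z) (β : Y ⟶ W)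
  [∀ y : Y, IsIso (α.stalkMap y)] [∀ y : Y, IsIso (β.stalkMap y)]

/-- Two maps from `Y` that are isomorphisms on stalks identify stalks of their targets. -/
def stalkTransfer (y : Y) : W.presheaf.stalk (β.base y) ≃* Z.presheaf.stalk (α.base y) :=
  (asIso (β.stalkMap y) ≪≫ (asIso (α.stalkMap y)).symm).commMonCatIsoToMulEquiv

/-- Stalk maps commute with specialisation maps, for `α` and for `β`. It is meant for an open set
`Y` with its inclusion into `X` and its isomorphism with `Spec M`. -/
lemma stalkTransfer_specializes {x y : Y} (h : x ⤳ y) (hα : α.base x ⤳ α.base y)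
    (hβ : β.base x ⤳ β.base y) (s : W.presheaf.stalk (β.base y)) :
    (Z.presheaf.stalkSpecializes hα).hom (stalkTransfer α β y s) =
      stalkTransfer α β x ((W.presheaf.stalkSpecializes hβ).hom s) := by
  have k1 := PresheafedSpace.stalkMap.stalkSpecializes_stalkMap α h
  have k2 := PresheafedSpace.stalkMap.stalkSpecializes_stalkMap β h
  have k3 : (β.stalkMap y ≫ inv (α.stalkMap y)) ≫ Z.presheaf.stalkSpecializes hα =
      W.presheaf.stalkSpecializes hβ ≫ β.stalkMap x ≫ inv (α.stalkMap x) := by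
    have k1' : inv (α.stalkMap y) ≫ Z.presheaf.stalkSpecializes hα =
        Y.presheaf.stalkSpecializes h ≫ inv (α.stalkMap x) := by
      rw [IsIso.inv_comp_eq, ← Category.assoc, IsIso.eq_comp_inv]
      exact k1
    rw [Category.assoc, k1', ← Category.assoc, ← Category.assoc]
    exact congrArg (· ≫ _) k2.symm
  exact ConcreteCategory.congr_hom k3 s

end

variable (X : MonoidScheme.{u})

/-- An affine open neighbourhood, with the maps from the coordinate monoid to the stalks. -/
structure Chart where
  U : Opens X.carrier
  M : CommMonCat.{u}
  homeo : U ≃ₜ PrimeIdeal M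
  toStalk : ∀ y : U, M →* X.Stalk y.1
  stalkRes_toStalk : ∀ (y z : U) (h : y.1 ⤳ z.1) (m : M),
    X.stalkRes h (toStalk z m) = toStalk y m
  isUnit_toStalk : ∀ (y : U) (m : M), IsUnit (toStalk y m) ↔ m ∉ (homeo y).carrier
  exists_fraction : ∀ (y : U) (c : X.Stalk y.1), ∃ a f : M, f ∉ (homeo y).carrier ∧
    c * toStalk y f = toStalk y a

open AlgebraicGeometry in
-- The canonical maps from `M` to the stalks of `Spec M` are carried to the stalks of `X`, through
-- the isomorphism of the affine neighbourhood with `Spec M`.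
lemma exists_chart (x : X.carrier) : ∃ C : Chart X, x ∈ C.U := by
  obtain ⟨U, M, ⟨e⟩⟩ := X.local_affine x
  let Y := X.toSheafedSpace.restrict U.isOpenEmbedding
  have hβ : ∀ y : Y.toPresheafedSpace, IsIso (e.hom.hom.stalkMap y) := fun y => inferInstance
  let σ : ∀ y : Y, (Spec M).presheaf.stalk (e.hom.hom.base y) ≃* X.presheaf.stalk y.1 :=
    @stalkTransfer _ _ _ (X.toPresheafedSpace.ofRestrict U.isOpenEmbedding) e.hom.hom _ hβ
  refine ⟨⟨U.1, M, TopCat.homeoOfIso ((SheafedSpace.forget _).mapIso e),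
    fun y => (σ y).toMonoidHom.comp (toSpecStalk M (e.hom.hom.base y)), ?_, ?_, ?_⟩, U.2⟩
  · intro y z h m
    have h' : (show Y from y) ⤳ (show Y from z) :=
      Topology.IsInducing.subtypeVal.specializes_iff.1 h
    have h'' := h'.map (ConcreteCategory.hom e.hom.hom.base).continuous
    refine (@stalkTransfer_specializes _ _ _ (X.toPresheafedSpace.ofRestrict U.isOpenEmbedding)
      e.hom.hom _ hβ _ _ h' h h'' _).trans (congrArg (σ y) ?_)
    exact fracGerm_specializes M h'' _ _ _ _
  · intro y m
    exact (MulEquiv.isUnit_map (σ y)).trans (isUnit_toSpecStalk M _ m)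
  · intro y c
    obtain ⟨a, f, hf, h⟩ := exists_eq_fracGerm M (e.hom.hom.base y) ((σ y).symm c)
    refine ⟨a, f, hf, ?_⟩
    obtain rfl := (MulEquiv.symm_apply_eq _).1 h
    exact ((σ y).map_mul _ _).symm.trans (congrArg (σ y) (fracGerm_mul_toSpecStalk M _ a f hf))

variable {X}

namespace Chart

variable (C : Chart X)

lemma specializes_iff {y z : C.U} :
    y.1 ⤳ z.1 ↔ (C.homeo y).carrier ⊆ (C.homeo z).carrier := by
  rw [← PrimeIdeal.specializes_iff, C.homeo.isInducing.specializes_iff,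
    Topology.IsInducing.subtypeVal.specializes_iff]

end Chart

/-! ### Generic points and generalisations in a chart -/

/-- This makes generic points unique, since points that specialise to each other are equal. -/
instance : T0Space X.carrier := by
  refine T0Space.of_open_cover fun x => ?_
  obtain ⟨C, hC⟩ := exists_chart X x
  exact ⟨C.U, hC, C.U.isOpen, C.homeo.isEmbedding.t0Space⟩

/-- Locally there is a generic point, and its stalk is a group. -/
lemma exists_generic (x : X.carrier) : ∃ (U : Opens X.carrier) (η : X.carrier), x ∈ U ∧ η ∈ U ∧
    (∀ y ∈ U, η ⤳ y) ∧ ∀ a : X.Stalk η, IsUnit a := by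
  obtain ⟨C, hC⟩ := exists_chart X x
  -- The empty prime lies in every prime, and no element of the monoid belongs to it, so all of them
  -- become invertible at `η`.
  let η := C.homeo.symm (PrimeIdeal.empty C.M)
  have hη : (C.homeo η).carrier = ∅ := by rw [Homeomorph.apply_symm_apply]; rfl
  refine ⟨C.U, η, hC, η.2, fun y hy => ?_, fun a => ?_⟩
  · refine (C.specializes_iff (y := η) (z := ⟨y, hy⟩)).2 ?_
    rw [hη]
    exact Set.empty_subset _
  · obtain ⟨m, f, hf, h⟩ := C.exists_fraction η a
    exact isUnit_of_mul_isUnit_left (h ▸ (C.isUnit_toStalk η m).2 (by rw [hη]; exact id))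

/-- The localisation of a stalk at one element is the stalk at a generalisation. -/
lemma exists_specializes_isUnit (x : X.carrier) (f : X.Stalk x) :
    ∃ (q : X.carrier) (h : q ⤳ x), IsUnit (X.stalkRes h f) ∧
      ∀ d : X.Stalk x, IsUnit (X.stalkRes h d) → ∃ n : ℕ, d ∣ f ^ n := by
  obtain ⟨C, hC⟩ := exists_chart X x
  let y : C.U := ⟨x, hC⟩
  -- Here `f = a / g` with `g` already invertible at `x`, so inverting `f` amounts to inverting `a`.
  obtain ⟨a, g, hg, hf⟩ := C.exists_fraction y f
  let q := C.homeo.symm ((C.homeo y).avoid a)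
  have hq : (C.homeo q).carrier = ((C.homeo y).avoid a).carrier := by
    rw [Homeomorph.apply_symm_apply]
  have hqy : q.1 ⤳ y.1 := by
    refine C.specializes_iff.2 fun m hm => ?_
    rw [hq] at hm
    by_contra hm'
    exact hm 0 m hm' (by rw [pow_zero, mul_one])
  have hu : ∀ {m : C.M}, m ∉ (C.homeo y).carrier → IsUnit (C.toStalk y m) := fun h =>
    (C.isUnit_toStalk _ _).2 h
  refine ⟨q, hqy, ?_, fun d hd => ?_⟩
  · have h1 : IsUnit (X.stalkRes hqy (C.toStalk y a)) := by
      rw [C.stalkRes_toStalk q y hqy, C.isUnit_toStalk, hq]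
      exact fun h => h 1 1 (PrimeIdeal.one_notMem _) (by simp)
    rw [← hf, map_mul] at h1
    exact isUnit_of_mul_isUnit_left h1
  · obtain ⟨c, k, hk, hc⟩ := C.exists_fraction y d
    have h1 : IsUnit (X.stalkRes hqy (C.toStalk y c)) := by
      rw [← hc, map_mul]
      exact hd.mul ((hu hk).map _)
    rw [C.stalkRes_toStalk q y hqy, C.isUnit_toStalk, hq] at h1
    change ¬ ∀ (n : ℕ), ∀ s ∉ (C.homeo y).carrier, ¬ c ∣ s * a ^ n at h1
    push Not at h1
    obtain ⟨n, s, hs, hcs⟩ := h1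
    -- From `c ∣ s a^n` and `d k = c` it follows that `d ∣ s (f g)^n`, where `s` and `g` are units
    -- at `x`.
    refine ⟨n, ?_⟩
    have h2 : d ∣ C.toStalk y s * C.toStalk y a ^ n := by
      rw [← map_pow, ← map_mul]
      exact (Dvd.intro _ hc).trans (map_dvd (C.toStalk y) hcs)
    rw [← hf, mul_pow] at h2
    rwa [(hu hs).dvd_mul_left, ((hu hg).pow n).dvd_mul_right] at h2

end

section

/-! ### Localisations of monoids in which every element is `s`-regular -/

section

variable {A B : Type u} [CommMonoid A] [CommMonoid B]

/-- A localisation of a monoid whose elements are all `s`-regular induces a bijection of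
the groups obtained by inverting the `s`-regular elements. -/
lemma sLocMap_bijective {f : A →* B} (hf : IsLocalizing f)
    (hf' : ∀ a, IsSRegular a → IsSRegular (f a)) (hA : ∀ a : A, IsSRegular a) :
    Function.Bijective (sLocMap f hf') := by
  have hmap : ∀ a, sLocMap f hf' (Localization.monoidOf _ a) = Localization.monoidOf _ (f a) :=
    fun a => Submonoid.LocalizationMap.lift_eq _ _ _
  have hunit : ∀ a : A, IsUnit (Localization.monoidOf (sRegular A) a) := fun a =>
    (Localization.monoidOf _).map_units ⟨a, hA a⟩
  constructor
  -- If `c f(a) = c f(b)`, write `c` as a fraction `f(e) / f(d)`; then `f(ea) = f(eb)`, so `k e a =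
  -- k e b` for some `k`, and `k e` is invertible after localisation because all elements of `A` are
  -- `s`-regular.
  · have key : ∀ a b : A, Localization.monoidOf (sRegular B) (f a) =
        Localization.monoidOf (sRegular B) (f b) →
          Localization.monoidOf (sRegular A) a = Localization.monoidOf (sRegular A) b := by
      intro a b h
      obtain ⟨c, hc⟩ := (Localization.monoidOf (sRegular B)).eq_iff_exists.1 h
      obtain ⟨d, e, -, hde⟩ := hf.1 c
      have h1 : f (e * a) = f (e * b) := by
        rw [map_mul, map_mul, ← hde, mul_right_comm, hc, mul_right_comm]
      obtain ⟨k, -, hk⟩ := hf.2 _ _ h1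
      rw [← mul_assoc, ← mul_assoc] at hk
      refine (hunit (k * e)).mul_left_cancel ?_
      rw [← map_mul, ← map_mul, hk]
    intro s t h
    obtain ⟨⟨a, b⟩, hs⟩ := (Localization.monoidOf (sRegular A)).surj s
    obtain ⟨⟨c, d⟩, ht⟩ := (Localization.monoidOf (sRegular A)).surj t
    dsimp only at hs ht
    have h1 := congrArg (sLocMap f hf') hs
    have h2 := congrArg (sLocMap f hf') ht
    rw [map_mul, hmap, hmap] at h1 h2
    refine ((hunit b).mul (hunit d)).mul_right_cancel ?_
    rw [← mul_assoc, hs, mul_comm (Localization.monoidOf (sRegular A) (b : A)), ← mul_assoc, ht,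
      ← map_mul, ← map_mul]
    apply key
    rw [map_mul f, map_mul f, map_mul, map_mul, ← h1, ← h2, h]
    ac_rfl
  · intro s
    obtain ⟨⟨a, b⟩, hs⟩ := (Localization.monoidOf (sRegular B)).surj s
    obtain ⟨d, e, hd, hde⟩ := hf.1 a
    obtain ⟨d', e', hd', hde'⟩ := hf.1 b
    dsimp only at hs
    -- With `s = a / b`, `a = f(e) / f(d)` and `b = f(e') / f(d')`, the preimage is `e d' / (d e')`.
    refine ⟨Localization.mk (e * d') ⟨d * e', hA _⟩, ?_⟩
    have hu : IsUnit (Localization.monoidOf (sRegular B) (f (d * e'))) :=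
      (Localization.monoidOf _).map_units ⟨_, hf' _ (hA _)⟩
    refine hu.mul_right_cancel ?_
    rw [← hmap, ← map_mul, Localization.mk_eq_monoidOf_mk',
      Submonoid.LocalizationMap.mk'_spec, hmap, hmap, map_mul f, map_mul f, ← hde, ← hde',
      map_mul, map_mul, map_mul, map_mul, ← hs]
    ac_rfl

end

variable {X : MonoidScheme.{u}}

open OSet

namespace MonoidScheme

lemma stalkRes_stalkRes {r q p : X.carrier} (h : q ⤳ p) (h' : r ⤳ q) (a : X.Stalk p) :
    X.stalkRes h' (X.stalkRes h a) = X.stalkRes (h'.trans h) a :=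
  ConcreteCategory.congr_hom (TopCat.Presheaf.stalkSpecializes_comp X.presheaf h' h) a

lemma sMerMap_sMerMap {r q p : X.carrier} (h : q ⤳ p) (h' : r ⤳ q) (a : X.SMerAt p) :
    X.sMerMap h' (X.sMerMap h a) = X.sMerMap (h'.trans h) a := by
  have : (X.sMerMap h').comp (X.sMerMap h) = X.sMerMap (h'.trans h) :=
    (Localization.monoidOf (sRegular (X.Stalk p))).epic_of_localizationMap
      (MonoidHom.ext fun b => by
        change X.sMerMap h' (X.sMerMap h (Localization.monoidOf _ b)) =
          X.sMerMap (h'.trans h) (Localization.monoidOf _ b)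
        rw [sMerMap_monoidOf, sMerMap_monoidOf, sMerMap_monoidOf, stalkRes_stalkRes])
  exact DFunLike.congr_fun this a

/-! ### Generic points -/

/-- The generic point of the component of `x`. -/
def genPt (x : X.carrier) : X.carrier := (exists_generic x).choose_spec.choose

lemma exists_genPt_specializes (x : X.carrier) :
    ∃ U : Opens X.carrier, x ∈ U ∧ ∀ y ∈ U, genPt x ⤳ y :=
  ⟨_, (exists_generic x).choose_spec.choose_spec.1,
    (exists_generic x).choose_spec.choose_spec.2.2.1⟩

lemma isUnit_stalk_genPt (x : X.carrier) (a : X.Stalk (genPt x)) : IsUnit a :=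
  (exists_generic x).choose_spec.choose_spec.2.2.2 a

/-- Open sets are stable under generalisation, so the neighbourhood of `p` on which `genPt p` is
generic contains `q`. -/
lemma genPt_specializes_of_specializes {q p : X.carrier} (h : q ⤳ p) : genPt p ⤳ q := by
  obtain ⟨U, hp, hU⟩ := exists_genPt_specializes p
  exact hU q (h.mem_open U.isOpen hp)

lemma genPt_specializes (x : X.carrier) : genPt x ⤳ x :=
  genPt_specializes_of_specializes specializes_rfl

lemma genPt_mem {U : Opens X.carrier} {x : X.carrier} (hx : x ∈ U) : genPt x ∈ U :=
  (genPt_specializes x).mem_open U.isOpen hx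

/-- Each of the two points specialises to the other, and the space is `T0`. -/
lemma genPt_eq {q p : X.carrier} (h : q ⤳ p) : genPt q = genPt p :=
  ((genPt_specializes_of_specializes (genPt_specializes_of_specializes h)).antisymm
    (genPt_specializes_of_specializes ((genPt_specializes q).trans h))).eq

lemma genPt_isLocallyConstant : IsLocallyConstant (genPt (X := X)) := by
  refine (IsLocallyConstant.iff_exists_open _).2 fun x => ?_
  obtain ⟨U, hx, hU⟩ := exists_genPt_specializes x
  exact ⟨U, U.isOpen, hx, fun y hy => (genPt_eq (hU y hy)).symm.trans
    (genPt_eq (genPt_specializes x))⟩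

/-! ### `s`-cancellative schemes -/

/-- The equation `a^m u = a^m v` gives `u = v` at the generic point, where `a` is invertible. Both
`u` and `v` are units at the generalisation `q` where `uv` is inverted, so `s`-cancellativity gives
`u = v` there. -/
lemma IsSCancellative.isSRegular (hX : X.IsSCancellative) (x : X.carrier) (a : X.Stalk x) :
    IsSRegular a := by
  intro m u v h
  obtain ⟨q, hq, hf, hd⟩ := exists_specializes_isUnit x (u * v)
  rw [map_mul, IsUnit.mul_iff] at hf
  have hη : genPt x ⤳ q := genPt_specializes_of_specializes hq
  have h1 : X.stalkRes (hη.trans hq) u = X.stalkRes (hη.trans hq) v := by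
    have := congrArg (X.stalkRes (hη.trans hq)) h
    rw [map_mul, map_mul] at this
    exact (isUnit_stalk_genPt x _).mul_left_cancel this
  have h2 : hf.1.unit = hf.2.unit := hX _ _ hη (Units.ext (by
    change X.stalkRes hη (X.stalkRes hq u) = X.stalkRes hη (X.stalkRes hq v)
    rwa [stalkRes_stalkRes, stalkRes_stalkRes]))
  -- Equality at `q` means `d u = d v` in the stalk at `x` for some `d` invertible at `q`; such a
  -- `d` divides a power of `uv`.
  obtain ⟨d, hdu, hd'⟩ := (isLocalizing_specializes X hq).2 u v (congrArg Units.val h2)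
  obtain ⟨n, c, hc⟩ := hd d hdu
  refine ⟨n, ?_⟩
  rw [hc, mul_comm d, mul_assoc, mul_assoc, hd']

lemma IsSCancellative.sMerMap_bijective (hX : X.IsSCancellative) {q p : X.carrier} (h : q ⤳ p) :
    Function.Bijective (X.sMerMap h) :=
  sLocMap_bijective (isLocalizing_specializes X h) _ (hX.isSRegular p)

/-- The isomorphism of groups of semi-meromorphic germs along a specialisation. -/
def IsSCancellative.sMerEquiv (hX : X.IsSCancellative) {q p : X.carrier} (h : q ⤳ p) :
    (X.SMerAt p)ˣ ≃* (X.SMerAt q)ˣ :=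
  Units.mapEquiv (MulEquiv.ofBijective (X.sMerMap h) (hX.sMerMap_bijective h))

lemma IsSCancellative.map_sMerEquiv_symm (hX : X.IsSCancellative) {q p : X.carrier} (h : q ⤳ p)
    (a : (X.SMerAt q)ˣ) : X.sMerMap h ((hX.sMerEquiv h).symm a : (X.SMerAt p)ˣ) = a :=
  congrArg Units.val ((hX.sMerEquiv h).apply_symm_apply a)

/-- A section of `sM_X^*` with given values at the generic points. -/
lemma IsSCancellative.exists_smVal_genPt (hX : X.IsSCancellative) (U : Opens X.carrier)
    (w : ∀ y ∈ U, (X.SMerAt y)ˣ) :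
    ∃ f : X.SMerUnits U, ∀ x (hx : x ∈ U),
      smVal (genPt x) (genPt_mem hx) f = w (genPt x) (genPt_mem hx) := by
  -- The value at `p` is transported from `genPt p`. The point `η` is a variable because the generic
  -- points of `q` and of its specialisation `p` are equal but not syntactically the same.
  have key : ∀ (p : X.carrier) (hp : p ∈ U) (η : X.carrier) (hη : η = genPt p) (h : η ⤳ p)
      (hηU : η ∈ U), X.sMerMap h ((hX.sMerEquiv (genPt_specializes p)).symm
        (w (genPt p) (genPt_mem hp)) : (X.SMerAt p)ˣ) = w η hηU := by
    rintro p hp _ rfl h hηU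
    exact hX.map_sMerEquiv_symm _ _
  refine ⟨smMk U (fun x hx => (hX.sMerEquiv (genPt_specializes x)).symm
    (w (genPt x) (genPt_mem hx))) fun q p h hq hp => Units.ext ?_, fun x hx => ?_⟩
  · refine (hX.sMerMap_bijective (genPt_specializes q)).1 ?_
    refine (sMerMap_sMerMap _ _ _).trans ?_
    rw [key p hp _ (genPt_eq h) _ (genPt_mem hq), key q hq _ rfl _ (genPt_mem hq)]
  · rw [← smVal_map (genPt_specializes x) (genPt_mem hx) hx, smVal_smMk]
    exact key x hx _ rfl _ _

/-- The value at `x` and the value at `genPt x` determine each other, by bijectivity of `sMerMap`.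
-/
lemma IsSCancellative.ext_genPt (hX : X.IsSCancellative) {U : Opens X.carrier}
    {f g : X.SMerUnits U} (h : ∀ x (hx : x ∈ U), smVal (genPt x) (genPt_mem hx) f =
      smVal (genPt x) (genPt_mem hx) g) : f = g :=
  smVal_ext fun x hx => (hX.sMerMap_bijective (genPt_specializes x)).1 (by
    rw [smVal_map _ (genPt_mem hx), smVal_map _ (genPt_mem hx)]
    exact h x hx)

/-! ### Surjectivity and constancy for `s`-cancellative schemes -/

/-- At each generic point `η` fix a frame `ε η`. A frame `e` of `L` is matched with the section of
`sM_X^*` whose value at every `η` is the germ of `e / ε η`. The choices at different generic points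
need no compatibility, since a section may take arbitrary unit values there. -/
lemma IsSCancellative.exists_isAssociated (hX : X.IsSCancellative) (L : LineBundle X) :
    ∃ D : X.SDivisor, X.IsAssociated D L := by
  choose N hN ε hε using L.exists_frame
  have H : FrameRep L fun U f e => IsFrame e ∧ ∀ x (hx : x ∈ U) (W : Opens X.carrier)
      (hU : W ≤ U) (hWN : W ≤ N (genPt x)) (hη : genPt x ∈ W) (g : (X.Sec W)ˣ),
        L.res hU e = (g : X.Sec W) • L.res hWN (ε (genPt x)) →
          smVal (genPt x) (genPt_mem hx) f =
            Localization.monoidOf _ (X.presheaf.germ W (genPt x) hη (g : X.Sec W)) := by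
    refine ⟨fun U f e h => h.1, fun x => ?_, ?_⟩
    · obtain ⟨U, hxU, e, he⟩ := L.exists_frame x
      -- Coordinates are taken at every point of `U`, but only those at generic points enter into
      -- `f`.
      have hg := fun y (hy : y ∈ U) => he.exists_unit (hε y)
        (inf_le_left : U ⊓ N y ≤ U) inf_le_right
      choose g hg using hg
      obtain ⟨f, hf⟩ := hX.exists_smVal_genPt U fun y hy =>
        Units.map ((Localization.monoidOf (sRegular (X.Stalk y))).toMonoidHom.comp
          (X.presheaf.germ (U ⊓ N y) y ⟨hy, hN y⟩).hom) (g y hy)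
      refine ⟨U, hxU, f, e, he, fun z hz W hU hWN hη k hk => (hf z hz).trans ?_⟩
      refine congrArg (Localization.monoidOf _) ?_
      have hηT : genPt z ∈ U ⊓ N (genPt z) := ⟨genPt_mem hz, hN _⟩
      have hle : W ≤ U ⊓ N (genPt z) := le_inf hU hWN
      have h1 := congrArg (L.res hle) (hg _ (genPt_mem hz))
      rw [res_smul, OSet.res_res, OSet.res_res, hk] at h1
      rw [(hε _).smul_cancel hWN h1]
      exact (TopCat.Presheaf.germ_res_apply X.presheaf (homOfLE hle) _ hη _).symm
    · rintro U f e V f' e' ⟨he, hf⟩ ⟨he', hf'⟩ W hU hV g hg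
      -- At each generic point: if `e = g e'` and `e' = k ε` near it, then `e = g k ε`, so the
      -- values of `f` and `f'` differ by the germ of `g`.
      refine hX.ext_genPt fun x hx => ?_
      have hη : genPt x ∈ W ⊓ N (genPt x) := ⟨genPt_mem hx, hN _⟩
      obtain ⟨k, hk⟩ := he'.exists_unit (hε (genPt x)) (inf_le_left.trans hV)
        (inf_le_right : W ⊓ N (genPt x) ≤ _)
      have hk' : L.res (inf_le_left.trans hU) e =
          ((Units.map (X.res inf_le_left) g * k : (X.Sec (W ⊓ N (genPt x)))ˣ) :
            X.Sec (W ⊓ N (genPt x))) • L.res inf_le_right (ε (genPt x)) := by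
        have h1 := congrArg (L.res (inf_le_left : W ⊓ N (genPt x) ≤ W)) hg
        rw [res_smul, OSet.res_res, OSet.res_res, hk, ← mul_smul] at h1
        exact h1
      rw [map_mul, smVal_res, smVal_res, hf x (hU hx) _ _ _ hη _ hk',
        hf' x (hV hx) _ _ _ hη _ hk, smVal_units, Units.val_mul, map_mul, map_mul]
      congr 2
      exact TopCat.Presheaf.germ_res_apply X.presheaf (homOfLE _) _ hη _
  obtain ⟨D, hD⟩ := H.exists_sDivisor
  exact ⟨D, H.isAssociated hD⟩

/-- A connected `W` has a single generic point `η`, which lies in every nonempty open subset of `W`.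
A section is determined by its value at `η`, an arbitrary element of the group of units there. -/
lemma IsSCancellative.sMerUnitsConstantOn (hX : X.IsSCancellative) {W : Opens X.carrier}
    (hW : _root_.IsConnected (W : Set X.carrier)) : X.SMerUnitsConstantOn W := by
  obtain ⟨x₀, hx₀⟩ := hW.nonempty
  let η := genPt x₀
  have hη : ∀ {x}, x ∈ W → genPt x = η := fun hx =>
    genPt_isLocallyConstant.apply_eq_of_isPreconnected hW.isPreconnected hx hx₀
  have hs : ∀ {x}, x ∈ W → η ⤳ x := fun {x} hx => by
    rw [← hη hx]
    exact genPt_specializes x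
  have hm : ∀ {U : Opens X.carrier}, U ≤ W → ∀ x ∈ U, η ∈ U := fun hU x hx =>
    (hs (hU hx)).mem_open (Opens.isOpen _) hx
  let F : ∀ U : Opens X.carrier, U ≤ W → (X.SMerUnits U →* LocallyConstant U (X.SMerAt η)ˣ) :=
    fun U hU =>
    -- The value at `η` does not depend on `x`; the point `x` only witnesses `η ∈ U`, so the empty
    -- set needs no separate treatment.
    { toFun := fun f => ⟨fun x => Units.map (smVal η (hm hU x.1 x.2)) (toUnits f),
        IsLocallyConstant.of_constant _ fun _ _ => rfl⟩
      map_one' := LocallyConstant.ext fun x => by simp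
      map_mul' := fun f g => LocallyConstant.ext fun x => by simp }
  have hF : ∀ (U : Opens X.carrier) (hU : U ≤ W) (f : X.SMerUnits U) (x : U),
      ((F U hU f x : (X.SMerAt η)ˣ) : X.SMerAt η) = X.sMerMap (hs (hU x.2)) (smVal x.1 x.2 f) :=
    fun U hU f x => (smVal_map (hs (hU x.2)) (hm hU x.1 x.2) x.2 f).symm
  have bij : ∀ U hU, Function.Bijective (F U hU) := by
    refine fun U hU => ⟨fun f g h => smVal_ext fun x hx => ?_, fun c => ?_⟩
    · refine (hX.sMerMap_bijective (hs (hU hx))).1 ?_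
      rw [← hF U hU f ⟨x, hx⟩, ← hF U hU g ⟨x, hx⟩, h]
    · refine ⟨smMk U (fun x hx => (hX.sMerEquiv (hs (hU hx))).symm (c ⟨x, hx⟩))
        fun q p h hq hp => Units.ext ?_, LocallyConstant.ext fun x => Units.ext ?_⟩
      -- Fibres of a locally constant function are open, hence contain the generalisations of their
      -- points.
      · have hc : c ⟨q, hq⟩ = c ⟨p, hp⟩ := by
          have h' : (⟨q, hq⟩ : U) ⤳ ⟨p, hp⟩ := Topology.IsInducing.subtypeVal.specializes_iff.1 h
          exact h'.mem_open (c.isLocallyConstant.isOpen_fiber _) rfl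
        refine (hX.sMerMap_bijective (hs (hU hq))).1 ?_
        refine (sMerMap_sMerMap _ _ _).trans ?_
        rw [hX.map_sMerEquiv_symm, hX.map_sMerEquiv_symm, hc]
      · rw [hF U hU, smVal_smMk, hX.map_sMerEquiv_symm]
  exact ⟨(X.SMerAt η)ˣ, inferInstance, fun U hU => MulEquiv.ofBijective (F U hU) (bij U hU),
    fun U V hU h f x => rfl⟩

end MonoidScheme

end

end MonoidGeometry

end

theorem mainTheorem6 (X : MonoidGeometry.MonoidScheme.{u}) :
    (∃ φ : X.SCl →* MonoidGeometry.Pic X,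
      (∀ (D : X.SDivisor) (L : MonoidGeometry.LineBundle X),
        φ (QuotientGroup.mk D) = MonoidGeometry.Pic.mk L ↔ X.IsAssociated D L) ∧
      Function.Injective φ ∧
      (X.IsSCancellative → Function.Bijective φ)) ∧
    (X.IsSCancellative → ∀ W : TopologicalSpace.Opens X.carrier,
      _root_.IsConnected (W : Set X.carrier) → X.SMerUnitsConstantOn W) := by
  refine ⟨⟨MonoidGeometry.sClHom X, fun D L => MonoidGeometry.sClHom_mk_eq_iff,
    MonoidGeometry.sClHom_injective, fun hX => ⟨MonoidGeometry.sClHom_injective, fun p => ?_⟩⟩,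
    fun hX W hW => hX.sMerUnitsConstantOn hW⟩
  obtain ⟨L, rfl⟩ := Quotient.exists_rep p
  obtain ⟨D, hD⟩ := hX.exists_isAssociated L
  exact ⟨QuotientGroup.mk D, MonoidGeometry.sClHom_mk_eq_iff.2 hD⟩
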